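/- Let $k$ be a field and let $\mathscr{C}$ be an essentially small $k$-linear $\operatorname{Hom}$-finite triangulated category with split idempotents and suspension functor $\Sigma$. Let $\mathscr{S} = \{ s_1, \ldots, s_e \}$ be a $2$-orthogonal collection in $\mathscr{C}$, where, for an integer $w \geqslant 1$, the collection $\mathscr{S}$ is called $w$-orthogonal if each $\mathscr{C}(s_i,s_i)$ is a skew field, $\mathscr{C}(s_i,s_j) = 0$ for $i \neq j$, and $\mathscr{C}(s_i,\Sigma^{\ell}s_j) = 0$ for all $i,j$ and $-w+1 \leqslant \ell \leqslant -1$. For classes of objects $\mathscr{A},\mathscr{B}$ of $\mathscr{C}$ let $\mathscr{A} * \mathscr{B}$ be the class of objects $x$ for which there is a triangle $a \to x \to b \to \Sigma a$ with $a \in \mathscr{A}$, $b \in \mathscr{B}$. Let $\langle \mathscr{S} \rangle = \bigcup_{n \geqslant 0} (\mathscr{S})_n$ be the extension closure of $\mathscr{S}$, where $(\mathscr{S})_0 = \{ 0 \}$ and $(\mathscr{S})_n = (\mathscr{S})_{n-1} * (\mathscr{S} \cup \{ 0 \})$ for $n \geqslant 1$. A $\Sigma\langle \mathscr{S} \rangle$-envelope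 of an object $x$ is a morphism $\varphi : x \to y$ with $y \in \Sigma\langle \mathscr{S} \rangle$ such that each morphism from $x$ to an object of $\Sigma\langle \mathscr{S} \rangle$ factors through $\varphi$, and such that each $h : y \to y$ with $h\varphi = \varphi$ is an isomorphism. (a) If, for some integer $w \geqslant 2$, $\mathscr{S}$ is a $w$-simple minded system, that is, $\mathscr{S}$ is $w$-orthogonal and $\mathscr{C} = \langle \mathscr{S} \rangle * \Sigma^{-1}\langle \mathscr{S} \rangle * \cdots * \Sigma^{-w+1}\langle \mathscr{S} \rangle$, then each object of $\langle \mathscr{S} \rangle$ has a $\Sigma\langle \mathscr{S} \rangle$-envelope. (b) Assume that each object of $\langle \mathscr{S} \rangle$ has a $\Sigma\langle \mathscr{S} \rangle$-envelope. Then the following hold. (i) There are a finite dimensional $k$-algebra $A$ and a $k$-linear equivalence $\langle \mathscr{S} \rangle \simeq \operatorname{mod} A$, where $\operatorname{mod} A$ is the category of finitely generated right $A$-modules. (ii) Suppose that $k$ is algebraically closed, let $A$ be a finite dimensional $k$-algebra, and let $F : \langle \mathscr{S} \rangle \to \operatorname{mod} A$ be a $k$-linear equivalence. Then the Gabriel quiver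 of $A$ has vertices $s_1, \ldots, s_e$ and $\dim_k \mathscr{C}(s_j,\Sigma s_i)$ arrows from $s_i$ to $s_j$. Precisely, there are primitive idempotents $\varepsilon_1, \ldots, \varepsilon_e$ of $A$ such that each indecomposable projective right $A$-module is isomorphic to $\varepsilon_i A$ for exactly one $i$, such that the top of $\varepsilon_i A$ is isomorphic to $F(s_i)$, and such that $\dim_k \varepsilon_j (J/J^2) \varepsilon_i = \dim_k \mathscr{C}(s_j,\Sigma s_i)$ for all $i,j$, where $J$ is the Jacobson radical of $A$; here the Gabriel quiver has $\dim_k \varepsilon_j (J/J^2) \varepsilon_i$ arrows from vertex $i$ to vertex $j$. -/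

import Mathlib

open CategoryTheory CategoryTheory.Limits CategoryTheory.Pretriangulated

universe w v u

namespace SimpleMinded

section Triangulated

variable {C : Type u} [Category.{v} C] [HasZeroObject C] [HasShift C ℤ] [Preadditive C]
  [∀ n : ℤ, (shiftFunctor C n).Additive] [Pretriangulated C]

/-- The family `s_1, …, s_n` is a `w`-orthogonal collection: each endomorphism ring is a skew
field, there are no nonzero morphisms between different members, and there are no nonzero
morphisms `s_i ⟶ Σ^ℓ s_j` for `-w + 1 ≤ ℓ ≤ -1`. -/
structure IsOrthogonalCollection (w : ℕ) {n : ℕ} (s : Fin n → C) : Prop where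
  one_le : 1 ≤ w
  id_ne_zero : ∀ i, 𝟙 (s i) ≠ 0
  isIso_of_ne_zero : ∀ i (f : s i ⟶ s i), f ≠ 0 → IsIso f
  hom_eq_zero : ∀ i j, i ≠ j → ∀ f : s i ⟶ s j, f = 0
  hom_shift_eq_zero : ∀ ℓ : ℤ, -(w : ℤ) + 1 ≤ ℓ → ℓ ≤ -1 →
    ∀ i j (f : s i ⟶ (s j)⟦ℓ⟧), f = 0

/-- The classes `(S)_n`: `(S)_0` consists of the zero objects and
`(S)_{n+1} = (S)_n * (S ∪ {0})`, where `P * Q` is the class of the objects `X` that admit a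
triangle `p ⟶ X ⟶ q ⟶ Σ p` with `p` in `P` and `q` in `Q`. -/
def extensionStep (S : ObjectProperty C) : ℕ → ObjectProperty C
  | 0 => fun X => IsZero X
  | n + 1 => (extensionStep S n).extensionProduct (fun X => S X ∨ IsZero X)

/-- The extension closure `⟨S⟩ = ⋃ₙ (S)_n` of the class `S = {s_1, …, s_n}`. -/
def extensionClosure {n : ℕ} (s : Fin n → C) : ObjectProperty C :=
  fun X => ∃ m, extensionStep (ObjectProperty.ofObj s) m X

lemma mem_extensionClosure {n : ℕ} (s : Fin n → C) (i : Fin n) : extensionClosure s (s i) :=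
  ⟨1, _, _, _, _, _, contractible_distinguished₁ (s i), isZero_zero C, Or.inl ⟨i⟩⟩

/-- The class `Σ^i P`: the objects isomorphic to `Σ^i Y` for some `Y` in `P`. -/
def suspend (P : ObjectProperty C) (i : ℤ) : ObjectProperty C :=
  fun X => ∃ Y, P Y ∧ Nonempty (X ≅ Y⟦i⟧)

/-- The class `P * Σ⁻¹ P * ⋯ * Σ^(-w+1) P` (with `w` factors). -/
def negativeChain (P : ObjectProperty C) : ℕ → ObjectProperty C
  | 0 => fun X => IsZero X
  | w + 1 => (negativeChain P w).extensionProduct (suspend P (-(w : ℤ)))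

/-- A `w`-simple minded system: a `w`-orthogonal collection such that
`C = ⟨S⟩ * Σ⁻¹ ⟨S⟩ * ⋯ * Σ^(-w+1) ⟨S⟩`. -/
structure IsSimpleMindedSystem (w : ℕ) {n : ℕ} (s : Fin n → C) : Prop where
  orthogonal : IsOrthogonalCollection w s
  generates : ∀ X : C, negativeChain (extensionClosure s) w X

end Triangulated

/-- `f : X ⟶ Y` is a `P`-envelope of `X`: `Y` is in `P`, each morphism from `X` to an object of
`P` factors through `f`, and `f` is left minimal. -/
structure IsEnvelope {C : Type u} [Category.{v} C] (P : ObjectProperty C) {X Y : C}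
    (f : X ⟶ Y) : Prop where
  mem : P Y
  factors : ∀ Z, P Z → ∀ g : X ⟶ Z, ∃ h : Y ⟶ Z, f ≫ h = g
  minimal : ∀ h : Y ⟶ Y, f ≫ h = f → IsIso h

/-- `X` has a `P`-envelope. -/
def HasEnvelope {C : Type u} [Category.{v} C] (P : ObjectProperty C) (X : C) : Prop :=
  ∃ (Y : C) (f : X ⟶ Y), IsEnvelope P f

section Algebra

/-- A primitive idempotent of `A`: a nonzero idempotent `e` such that `e A e` has no
idempotents other than `0` and `e`. -/
structure IsPrimitiveIdempotent {A : Type*} [Ring A] (e : A) : Prop where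
  idem : IsIdempotentElem e
  ne_zero : e ≠ 0
  eq_or_eq : ∀ f : A, IsIdempotentElem f → e * f = f → f * e = f → f = 0 ∨ f = e

/-- The right `A`-module `e A`; right `A`-modules are modules over `Aᵐᵒᵖ`. -/
abbrev rightIdeal {A : Type*} [Ring A] (e : A) : Submodule Aᵐᵒᵖ A :=
  Submodule.span Aᵐᵒᵖ {e}

/-- The top `e A / rad (e A)` of the right `A`-module `e A`; it is simple if `e` is a primitive
idempotent of a finite dimensional algebra. -/
abbrev topModule {A : Type*} [Ring A] (e : A) : Type _ :=
  rightIdeal e ⧸ Module.jacobson Aᵐᵒᵖ (rightIdeal e)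

variable (k : Type*) {A : Type*} [Field k] [Ring A] [Algebra k A]

/-- The Jacobson radical `J` of `A` as a `k`-subspace. -/
def radical (A : Type*) [Ring A] [Algebra k A] : Submodule k A :=
  (Ring.jacobson A).restrictScalars k

/-- The `k`-subspace `f V e` of `A`. -/
def corner (f e : A) (V : Submodule k A) : Submodule k A :=
  V.map (LinearMap.mulLeftRight k (f, e))

/-- The vector space `f (J / J²) e = f J e / f J² e`. -/
abbrev arrowSpace (e f : A) : Type _ :=
  corner k f e (radical k A) ⧸
    (corner k f e (radical k A * radical k A)).submoduleOf (corner k f e (radical k A))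

/-- The quiver `Q` is the Gabriel quiver of the finite dimensional `k`-algebra `A`, where the
vertex `i` corresponds to the primitive idempotent `e i` (equivalently, to the indecomposable
projective right module `e i A`, and to its top, which is a simple right module).  The `e i`
represent each isomorphism class of indecomposable projective right modules exactly once, and
the arrows from `i` to `j` index a basis of `e j (J / J²) e i`, where `J` is the Jacobson
radical; that is, paths are composed like functions, from right to left. -/
structure IsGabrielQuiver (A : Type*) [Ring A] [Algebra k A] (Q : Type*) [Quiver Q]
    (e : Q → A) : Prop where
  primitive : ∀ i, IsPrimitiveIdempotent (e i)
  complete : ∀ f : A, IsPrimitiveIdempotent f →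
    ∃! i, Nonempty (rightIdeal f ≃ₗ[Aᵐᵒᵖ] rightIdeal (e i))
  arrows : ∀ i j, Nonempty (Module.Basis (i ⟶ j) k (arrowSpace k (e i) (e j)))

end Algebra

/-- The vertices of the quiver of a collection `s_1, …, s_n`. -/
def CollectionQuiver (_ : Type*) {C : Type*} {n : ℕ} (_ : Fin n → C) : Type :=
  Fin n

/-- There are `dim_k Hom (s_j, Σ s_i)` arrows from `s_i` to `s_j`. -/
noncomputable instance {k : Type w} [Field k] {C : Type u} [Category.{v} C] [HasShift C ℤ]
    [Preadditive C] [Linear k C] {n : ℕ} (s : Fin n → C) : Quiver (CollectionQuiver k s) where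
  Hom (i j : Fin n) := Fin (Module.finrank k (s j ⟶ (s i)⟦(1 : ℤ)⟧))

end SimpleMinded

/-! Write E for the extension closure of the `s i`. Orthogonality in degree -1 gives Hom(ΣE, E) = 0,
so E behaves like a length category with simple objects `s i`, whose short exact sequences are the
triangles with terms in E. First morphisms of such triangles can be cancelled (`comp_left_cancel`),
and a nonzero morphism to `s i` has a shorter fibre (`exists_fibre_of_ne_zero`), which makes E
closed under summands.

(a) The last layer of Σ⁻ʷX, suspended w times, lies in ΣE, while the other layers, so suspended,
have no nonzero morphisms to ΣE. This gives a left approximation of X, which Fitting's lemma and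
split idempotents cut down to a minimal one.

(b)(i) By Wakamatsu's lemma the cocone Q of an envelope X → ΣY satisfies Hom(Q, ΣE) = 0, so Q is a
projective cover of X with kernel Y. Let P be the sum of the covers of the `s i`. Then Hom(P, -) is
an equivalence from E to the finitely generated right End(P)-modules. Every morphism from P to `s i`
lifts along every nonzero morphism X → `s i` with X in E (`lift_of_ne_zero`), which gives
faithfulness. Fullness and density follow by induction on length, extensions of `s j` being pushed
out from its projective cover.

(b)(ii) An equivalence F from E to mod A sends the `s i` to the simple modules. If the primitive
idempotent e_j has top F(s_j), both e_j A and the image of the cover of s_j are projective covers of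
F(s_j), so the kernel of the cover goes to e_j J. Therefore Hom(s_j, Σs_i) ≅ Hom(ker, s_i) ≅
Hom_A(e_j J, F(s_i)), and the last space is dual to e_j (J/J²) e_i because End(F(s_i)) = k. -/

namespace SimpleMinded

section Triangulated

variable {C : Type u} [Category.{v} C] [HasZeroObject C] [HasShift C ℤ] [Preadditive C]
  [∀ n : ℤ, (shiftFunctor C n).Additive] [Pretriangulated C]

/-! ### Exactness of Hom on triangles -/

section Triangles

variable {Y X Z W : C} {f : Y ⟶ X} {g : X ⟶ Z} {h : Z ⟶ Y⟦(1 : ℤ)⟧}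
  (hT : Triangle.mk f g h ∈ distTriang C)
include hT

lemma triangle_comp₁₂ : f ≫ g = 0 := comp_distTriang_mor_zero₁₂ _ hT

lemma triangle_comp₂₃ : g ≫ h = 0 := comp_distTriang_mor_zero₂₃ _ hT

lemma triangle_comp₃₁ : h ≫ f⟦(1 : ℤ)⟧' = 0 := comp_distTriang_mor_zero₃₁ _ hT

lemma triangle_desc₂ (a : X ⟶ W) (ha : f ≫ a = 0) : ∃ b : Z ⟶ W, a = g ≫ b :=
  Triangle.yoneda_exact₂ _ hT a ha

lemma triangle_desc₃ (a : Z ⟶ W) (ha : g ≫ a = 0) : ∃ b : Y⟦(1 : ℤ)⟧ ⟶ W, a = h ≫ b :=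
  Triangle.yoneda_exact₃ _ hT a ha

open scoped ZeroObject in
lemma triangle_desc₁ (a : Y ⟶ W) (ha : h ≫ a⟦(1 : ℤ)⟧' = 0) : ∃ b : X ⟶ W, a = f ≫ b := by
  obtain ⟨b, hb, -⟩ := complete_distinguished_triangle_morphism₂ _ _ hT
    (contractible_distinguished W) a (0 : Z ⟶ 0) (ha.trans zero_comp.symm)
  exact ⟨b, (Category.comp_id a).symm.trans hb.symm⟩

lemma triangle_lift₁ (a : W ⟶ Y⟦(1 : ℤ)⟧) (ha : a ≫ f⟦(1 : ℤ)⟧' = 0) : ∃ b : W ⟶ Z, a = b ≫ h :=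
  Triangle.coyoneda_exact₁ _ hT a ha

lemma triangle_lift₂ (a : W ⟶ X) (ha : a ≫ g = 0) : ∃ b : W ⟶ Y, a = b ≫ f :=
  Triangle.coyoneda_exact₂ _ hT a ha

lemma triangle_lift₃ (a : W ⟶ Z) (ha : a ≫ h = 0) : ∃ b : W ⟶ X, a = b ≫ g :=
  Triangle.coyoneda_exact₃ _ hT a ha

variable {Y' X' Z' : C} {f' : Y' ⟶ X'} {g' : X' ⟶ Z'} {h' : Z' ⟶ Y'⟦(1 : ℤ)⟧}
  (hT' : Triangle.mk f' g' h' ∈ distTriang C)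
include hT'

lemma triangle_map₁ (b : X ⟶ X') (c : Z ⟶ Z') (hbc : g ≫ c = b ≫ g') :
    ∃ a : Y ⟶ Y', f ≫ b = a ≫ f' ∧ h ≫ a⟦(1 : ℤ)⟧' = c ≫ h' :=
  complete_distinguished_triangle_morphism₁ _ _ hT hT' b c hbc

lemma triangle_map₂ (a : Y ⟶ Y') (c : Z ⟶ Z') (hac : h ≫ a⟦(1 : ℤ)⟧' = c ≫ h') :
    ∃ b : X ⟶ X', f ≫ b = a ≫ f' ∧ g ≫ c = b ≫ g' :=
  complete_distinguished_triangle_morphism₂ _ _ hT hT' a c hac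

lemma triangle_isIso₁ (a : Y ⟶ Y') (b : X ⟶ X') (c : Z ⟶ Z') (hab : f ≫ b = a ≫ f')
    (hbc : g ≫ c = b ≫ g') (hac : h ≫ a⟦(1 : ℤ)⟧' = c ≫ h') [IsIso b] [IsIso c] : IsIso a :=
  isIso₁_of_isIso₂₃ (T := Triangle.mk f g h) (T' := Triangle.mk f' g' h')
    ⟨a, b, c, hab, hbc, hac⟩ hT hT' ‹_› ‹_›

lemma triangle_isIso₂ (a : Y ⟶ Y') (b : X ⟶ X') (c : Z ⟶ Z') (hab : f ≫ b = a ≫ f')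
    (hbc : g ≫ c = b ≫ g') (hac : h ≫ a⟦(1 : ℤ)⟧' = c ≫ h') [IsIso a] [IsIso c] : IsIso b :=
  isIso₂_of_isIso₁₃ (T := Triangle.mk f g h) (T' := Triangle.mk f' g' h')
    ⟨a, b, c, hab, hbc, hac⟩ hT hT' ‹_› ‹_›

end Triangles

lemma triangle_hom_eq_zero {Y X Z W : C} {f : Y ⟶ X} {g : X ⟶ Z} {h : Z ⟶ Y⟦(1 : ℤ)⟧}
    (hT : Triangle.mk f g h ∈ distTriang C) (hY : ∀ a : Y ⟶ W, a = 0) (hZ : ∀ a : Z ⟶ W, a = 0)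
    (a : X ⟶ W) : a = 0 := by
  obtain ⟨b, rfl⟩ := triangle_desc₂ hT a (hY _)
  rw [hZ b, comp_zero]

lemma hom_triangle_eq_zero {Y X Z W : C} {f : Y ⟶ X} {g : X ⟶ Z} {h : Z ⟶ Y⟦(1 : ℤ)⟧}
    (hT : Triangle.mk f g h ∈ distTriang C) (hY : ∀ a : W ⟶ Y, a = 0) (hZ : ∀ a : W ⟶ Z, a = 0)
    (a : W ⟶ X) : a = 0 := by
  obtain ⟨b, rfl⟩ := triangle_lift₂ hT a (hZ _)
  rw [hY b, zero_comp]

lemma hom_triangle_shift_eq_zero {Y X Z W : C} {f : Y ⟶ X} {g : X ⟶ Z} {h : Z ⟶ Y⟦(1 : ℤ)⟧}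
    (hT : Triangle.mk f g h ∈ distTriang C) (ℓ : ℤ) (hY : ∀ a : W ⟶ Y⟦ℓ⟧, a = 0)
    (hZ : ∀ a : W ⟶ Z⟦ℓ⟧, a = 0) (a : W ⟶ X⟦ℓ⟧) : a = 0 := by
  obtain ⟨b, hb⟩ : ∃ b : W ⟶ Y⟦ℓ⟧, a = b ≫ (ℓ.negOnePow • f⟦ℓ⟧') :=
    Triangle.coyoneda_exact₂ _ (Triangle.shift_distinguished _ hT ℓ) a (hZ _)
  rw [hb, hY b, zero_comp]

/-! ### The extension closure -/

section ExtensionStep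

variable (S : ObjectProperty C)

lemma extensionStep_of_iso (m : ℕ) {X Y : C} (e : X ≅ Y) (hX : extensionStep S m X) :
    extensionStep S m Y := by
  cases m with
  | zero => exact hX.of_iso e.symm
  | succ m => exact ((extensionStep S m).extensionProduct _).prop_of_iso e hX

lemma extensionStep_succ_of_triangle (m : ℕ) {Y X Z : C} {f : Y ⟶ X} {g : X ⟶ Z}
    {h : Z ⟶ Y⟦(1 : ℤ)⟧} (hT : Triangle.mk f g h ∈ distTriang C) (hY : extensionStep S m Y)
    (hZ : S Z) : extensionStep S (m + 1) X :=
  ⟨_, _, _, _, _, hT, hY, Or.inl hZ⟩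

lemma extensionStep_le_succ (m : ℕ) {X : C} (hX : extensionStep S m X) :
    extensionStep S (m + 1) X :=
  ⟨_, _, _, _, _, contractible_distinguished X, hX, Or.inr (isZero_zero C)⟩

lemma extensionStep_succ_cases {m : ℕ} {X : C} (hX : extensionStep S (m + 1) X) :
    extensionStep S m X ∨ ∃ (Y Z : C) (f : Y ⟶ X) (g : X ⟶ Z) (h : Z ⟶ Y⟦(1 : ℤ)⟧),
      Triangle.mk f g h ∈ distTriang C ∧ extensionStep S m Y ∧ S Z := by
  obtain ⟨Y, Z, f, g, h, hT, hY, hZ | hZ⟩ := hX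
  · exact Or.inr ⟨Y, Z, f, g, h, hT, hY, hZ⟩
  · have : IsIso f := (Triangle.isZero₃_iff_isIso₁ _ hT).1 hZ
    exact Or.inl (extensionStep_of_iso S m (asIso f) hY)

/-- This is associativity of `*`, which rests on the octahedral axiom. -/
lemma extensionStep_add [IsTriangulated C] (a b : ℕ) {Y X Z : C} {f : Y ⟶ X} {g : X ⟶ Z}
    {h : Z ⟶ Y⟦(1 : ℤ)⟧} (hT : Triangle.mk f g h ∈ distTriang C) (hY : extensionStep S a Y)
    (hZ : extensionStep S b Z) : extensionStep S (a + b) X := by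
  suffices (extensionStep S a).extensionProduct (extensionStep S b) ≤ extensionStep S (a + b) from
    this _ ⟨_, _, _, _, _, hT, hY, hZ⟩
  clear hT hY hZ
  induction b with
  | zero =>
    rintro X ⟨Y, Z, f, g, h, hT, hY, hZ⟩
    have : IsIso f := (Triangle.isZero₃_iff_isIso₁ _ hT).1 hZ
    exact extensionStep_of_iso S a (asIso f) hY
  | succ b ih =>
    change (extensionStep S a).extensionProduct ((extensionStep S b).extensionProduct _) ≤ _
    rw [← ObjectProperty.extensionProduct_assoc]
    exact ObjectProperty.monotone_extensionProduct_left _ ih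

end ExtensionStep

variable {n : ℕ} {s : Fin n → C}

lemma extensionClosure_of_isZero {X : C} (hX : IsZero X) : extensionClosure s X := ⟨0, hX⟩

lemma extensionClosure_extension [IsTriangulated C] {Y X Z : C} {f : Y ⟶ X} {g : X ⟶ Z}
    {h : Z ⟶ Y⟦(1 : ℤ)⟧} (hT : Triangle.mk f g h ∈ distTriang C) (hY : extensionClosure s Y)
    (hZ : extensionClosure s Z) : extensionClosure s X := by
  obtain ⟨a, ha⟩ := hY
  obtain ⟨b, hb⟩ := hZ
  exact ⟨a + b, extensionStep_add _ a b hT ha hb⟩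

lemma extensionClosure_biprod [IsTriangulated C] {X Y : C} (hX : extensionClosure s X)
    (hY : extensionClosure s Y) : extensionClosure s (X ⊞ Y) :=
  extensionClosure_extension (binaryBiproductTriangle_distinguished X Y) hX hY

/-- Objects of the extension closure are built from zero objects by extensions with the `s i`. -/
lemma extensionClosure_induction {motive : C → Prop} (zero : ∀ X, IsZero X → motive X)
    (step : ∀ ⦃X Y : C⦄ (i : Fin n) (f : Y ⟶ X) (g : X ⟶ s i) (h : s i ⟶ Y⟦(1 : ℤ)⟧),
      Triangle.mk f g h ∈ distTriang C → extensionClosure s Y → motive Y → motive X)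
    {X : C} (hX : extensionClosure s X) : motive X := by
  obtain ⟨m, hm⟩ := hX
  induction m generalizing X with
  | zero => exact zero X hm
  | succ m ih =>
    obtain h | ⟨Y, Z, f, g, h, hT, hY, ⟨i⟩⟩ := extensionStep_succ_cases _ hm
    · exact ih h
    · exact step i f g h hT ⟨m, hY⟩ (ih hY)

lemma hom_eq_zero_of_simples {W : C} (hW : ∀ i (f : s i ⟶ W), f = 0) {X : C}
    (hX : extensionClosure s X) (f : X ⟶ W) : f = 0 := by
  revert f
  refine extensionClosure_induction (motive := fun X => ∀ f : X ⟶ W, f = 0) ?_ ?_ hX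
  · exact fun X hX f => hX.eq_of_src _ _
  · exact fun X Y i a b c hT _ ih f => triangle_hom_eq_zero hT ih (hW i) f

lemma hom_shift_eq_zero_of_simples {W : C} (ℓ : ℤ) (hW : ∀ i (f : W ⟶ (s i)⟦ℓ⟧), f = 0) {X : C}
    (hX : extensionClosure s X) (f : W ⟶ X⟦ℓ⟧) : f = 0 := by
  revert f
  refine extensionClosure_induction (motive := fun X => ∀ f : W ⟶ X⟦ℓ⟧, f = 0) ?_ ?_ hX
  · exact fun X hX f => ((shiftFunctor C ℓ).map_isZero hX).eq_of_tgt _ _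
  · exact fun X Y i a b c hT _ ih f => hom_triangle_shift_eq_zero hT ℓ ih (hW i) f

lemma hom_eq_zero_of_hom_simples_eq_zero {W : C} (hW : ∀ i (f : W ⟶ s i), f = 0) {X : C}
    (hX : extensionClosure s X) (f : W ⟶ X) : f = 0 := by
  revert f
  refine extensionClosure_induction (motive := fun X => ∀ f : W ⟶ X, f = 0) ?_ ?_ hX
  · exact fun X hX f => hX.eq_of_tgt _ _
  · exact fun X Y i a b c hT _ ih f => hom_triangle_eq_zero hT ih (hW i) f

/-! ### Consequences of orthogonality -/

namespace IsOrthogonalCollection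

variable {w : ℕ}

lemma hom_shift_eq_zero' (hs : IsOrthogonalCollection w s) {ℓ : ℤ} (h₁ : -(w : ℤ) + 1 ≤ ℓ)
    (h₂ : ℓ ≤ -1) {X Y : C} (hX : extensionClosure s X) (hY : extensionClosure s Y)
    (f : X ⟶ Y⟦ℓ⟧) : f = 0 :=
  hom_shift_eq_zero_of_simples ℓ
    (fun j => hom_eq_zero_of_simples (fun i => hs.hom_shift_eq_zero ℓ h₁ h₂ i j) hX) hY f

omit [HasZeroObject C] [∀ n : ℤ, (shiftFunctor C n).Additive] [Pretriangulated C] in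
lemma eq_and_isIso (hs : IsOrthogonalCollection w s) {i j : Fin n} {f : s i ⟶ s j} (hf : f ≠ 0) :
    i = j ∧ IsIso f := by
  by_cases h : i = j
  · subst h
    exact ⟨rfl, hs.isIso_of_ne_zero i f hf⟩
  · exact (hf (hs.hom_eq_zero i j h f)).elim

omit [HasZeroObject C] [∀ n : ℤ, (shiftFunctor C n).Additive] [Pretriangulated C] in
lemma isIso (hs : IsOrthogonalCollection w s) {i j : Fin n} {f : s i ⟶ s j} (hf : f ≠ 0) :
    IsIso f :=
  (hs.eq_and_isIso hf).2

variable (hs : IsOrthogonalCollection 2 s)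
include hs

lemma shift_one_hom_eq_zero {X Y : C} (hX : extensionClosure s X) (hY : extensionClosure s Y)
    (f : X⟦(1 : ℤ)⟧ ⟶ Y) : f = 0 := by
  apply (shiftFunctor C (-1 : ℤ)).map_injective
  rw [← cancel_epi (shiftShiftNeg X (1 : ℤ)).inv, Functor.map_zero, comp_zero]
  exact hs.hom_shift_eq_zero' (by norm_num) le_rfl hX hY _

/-- The suspension of `u` factors through a morphism from ΣW to Z, and these vanish by
2-orthogonality. Thus first morphisms of triangles act as monomorphisms on the closure. -/
lemma comp_left_cancel {Y X Z W : C} {f : Y ⟶ X} {g : X ⟶ Z}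
    {h : Z ⟶ Y⟦(1 : ℤ)⟧} (hT : Triangle.mk f g h ∈ distTriang C) (hW : extensionClosure s W)
    (hZ : extensionClosure s Z) {u : W ⟶ Y} (hu : u ≫ f = 0) : u = 0 := by
  apply (shiftFunctor C (1 : ℤ)).map_injective
  obtain ⟨a, ha⟩ := triangle_lift₁ hT (u⟦(1 : ℤ)⟧') (by
    rw [← Functor.map_comp, hu, Functor.map_zero])
  rw [ha, hs.shift_one_hom_eq_zero hW hZ a, zero_comp, Functor.map_zero]

/-- A morphism to `s i` that is a monomorphism with respect to the extension closure is zero or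
an isomorphism. -/
lemma isIso_of_mono {X : C} (hX : extensionClosure s X) {i : Fin n} (f : X ⟶ s i) (hf : f ≠ 0)
    (hm : ∀ W, extensionClosure s W → ∀ u : W ⟶ X, u ≫ f = 0 → u = 0) : IsIso f := by
  suffices ∃ r : s i ⟶ X, r ≫ f = 𝟙 _ by
    obtain ⟨r, hr⟩ := this
    refine ⟨r, sub_eq_zero.1 (hm X hX _ ?_), hr⟩
    rw [Preadditive.sub_comp, Category.assoc, hr, Category.comp_id, Category.id_comp, sub_self]
  revert f
  refine extensionClosure_induction (motive := fun X => ∀ f : X ⟶ s i, f ≠ 0 →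
    (∀ W, extensionClosure s W → ∀ u : W ⟶ X, u ≫ f = 0 → u = 0) → ∃ r : s i ⟶ X, r ≫ f = 𝟙 _)
    ?_ ?_ hX
  · exact fun X hX f hf _ => (hf (hX.eq_of_src _ _)).elim
  · intro X Y j a b c hT hY ih f hf hm
    -- Either `f` factors through `s j`, which forces `Y` to vanish, or it is nonzero on `Y` and a
    -- section already exists there.
    by_cases h : a ≫ f = 0
    · obtain ⟨g, hg⟩ := triangle_desc₂ hT f h
      have hg0 : g ≠ 0 := by
        rintro rfl
        exact hf (hg.trans comp_zero)
      have := hs.isIso hg0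
      have hY0 : IsZero Y := by
        rw [IsZero.iff_id_eq_zero]
        apply hs.comp_left_cancel hT hY (mem_extensionClosure s j)
        rw [hm Y hY a h, comp_zero]
      obtain ⟨r, hr⟩ := triangle_lift₃ hT (𝟙 (s j))
        (((shiftFunctor C (1 : ℤ)).map_isZero hY0).eq_of_tgt _ _)
      refine ⟨inv g ≫ r, ?_⟩
      rw [hg, Category.assoc, ← Category.assoc r, ← hr, Category.id_comp, IsIso.inv_hom_id]
    · obtain ⟨r, hr⟩ := ih (a ≫ f) h (fun W hW u hu =>
        hs.comp_left_cancel hT hW (mem_extensionClosure s j)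
          (hm W hW _ (by rw [Category.assoc, hu])))
      exact ⟨r ≫ a, by rw [Category.assoc, hr]⟩

omit hs in
-- Nonzero morphisms to `s i` are epimorphisms from the viewpoint of a relatively projective `p`.
-- Along a filtration of X, `g` is nonzero on the subobject Y, or it is the projection to `s j`
-- followed by an isomorphism and the vanishing of Hom(p, ΣY) provides the lift.
lemma lift_of_ne_zero {w : ℕ} (hs : IsOrthogonalCollection w s) {X p : C}
    (hX : extensionClosure s X)
    (hp : ∀ Y, extensionClosure s Y → ∀ f : p ⟶ Y⟦(1 : ℤ)⟧, f = 0) {i : Fin n} (g : X ⟶ s i)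
    (hg : g ≠ 0) (a : p ⟶ s i) : ∃ b : p ⟶ X, b ≫ g = a := by
  revert g
  refine extensionClosure_induction
    (motive := fun X => ∀ g : X ⟶ s i, g ≠ 0 → ∃ b : p ⟶ X, b ≫ g = a) ?_ ?_ hX
  · exact fun X hX g hg => (hg (hX.eq_of_src _ _)).elim
  · intro X Y j f' g' h' hT hY ih g hg
    by_cases h : f' ≫ g = 0
    · obtain ⟨q, rfl⟩ := triangle_desc₂ hT g h
      have hq0 : q ≠ 0 := by
        rintro rfl
        exact hg comp_zero
      have := hs.isIso hq0
      obtain ⟨b, hb⟩ := triangle_lift₃ hT (a ≫ inv q) (hp Y hY _)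
      refine ⟨b, ?_⟩
      rw [← Category.assoc, ← hb, Category.assoc, IsIso.inv_hom_id, Category.comp_id]
    · obtain ⟨b, hb⟩ := ih (f' ≫ g) h
      exact ⟨b ≫ f', by rw [Category.assoc, hb]⟩

omit hs in
/-- The fibre of a nonzero morphism to `s i` has smaller length. -/
lemma exists_fibre_of_ne_zero [IsTriangulated C] {w : ℕ} (hs : IsOrthogonalCollection w s) {m : ℕ}
    {X : C} (hX : extensionStep (ObjectProperty.ofObj s) m X) {i : Fin n} (g : X ⟶ s i)
    (hg : g ≠ 0) : ∃ (m' : ℕ) (Z : C) (f : Z ⟶ X) (h : s i ⟶ Z⟦(1 : ℤ)⟧), m = m' + 1 ∧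
      Triangle.mk f g h ∈ distTriang C ∧ extensionStep (ObjectProperty.ofObj s) m' Z := by
  induction m generalizing X with
  | zero => exact (hg (IsZero.eq_of_src hX _ _)).elim
  | succ m ih =>
    obtain h | ⟨Y, _, u, v, w, hT, hY, ⟨j⟩⟩ := extensionStep_succ_cases _ hX
    · obtain ⟨m', Z, f, h', rfl, hT, hZ⟩ := ih h g hg
      exact ⟨_, Z, f, h', rfl, hT, extensionStep_le_succ _ _ hZ⟩
    · refine ⟨m, ?_⟩
      by_cases h : u ≫ g = 0
      · obtain ⟨q, hq⟩ := triangle_desc₂ hT g h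
        have hq0 : q ≠ 0 := by
          rintro rfl
          exact hg (hq.trans comp_zero)
        have := hs.isIso hq0
        refine ⟨Y, u, inv q ≫ w, rfl, ?_, hY⟩
        refine isomorphic_distinguished _ hT _
          (Triangle.isoMk _ _ (Iso.refl Y) (Iso.refl X) (asIso q).symm ?_ ?_ ?_)
        · change u ≫ 𝟙 X = 𝟙 Y ≫ u
          simp
        · change g ≫ inv q = 𝟙 X ≫ v
          simp [hq]
        · change (inv q ≫ w) ≫ (𝟙 Y)⟦(1 : ℤ)⟧' = inv q ≫ w
          simp
      · obtain ⟨m', Y', f', h', rfl, hT', hY'⟩ := ih hY _ h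
        obtain ⟨Z, f, h, hT''⟩ := distinguished_cocone_triangle₁ g
        refine ⟨Z, f, h, rfl, hT'', ?_⟩
        -- The octahedron on Y → X → `s i` gives `s j` → ΣY' → ΣZ → Σ`s j`. Rotated back twice, with
        -- the signs this costs, it exhibits Z as an extension of `s j` by Y'.
        let o := Triangulated.someOctahedron rfl hT (rot_of_distTriang _ hT'')
          (rot_of_distTriang _ hT')
        let m₁ : s j ⟶ Y'⟦(1 : ℤ)⟧ := o.m₁
        let m₃ : Y'⟦(1 : ℤ)⟧ ⟶ Z⟦(1 : ℤ)⟧ := o.m₃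
        let m₂ : Z⟦(1 : ℤ)⟧ ⟶ (s j)⟦(1 : ℤ)⟧ := o.triangle.mor₃
        obtain ⟨a, ha⟩ := (shiftFunctor C (1 : ℤ)).map_surjective m₃
        obtain ⟨b, hb⟩ := (shiftFunctor C (1 : ℤ)).map_surjective m₂
        refine extensionStep_succ_of_triangle _ m' (f := -a) (g := -b) (h := m₁) ?_ hY' ⟨j⟩
        rw [rotate_distinguished_triangle, rotate_distinguished_triangle]
        refine isomorphic_distinguished _ o.mem _ (Triangle.isoMk _ _ (Iso.refl (s j))
          (Iso.refl (Y'⟦(1 : ℤ)⟧)) (Iso.refl (Z⟦(1 : ℤ)⟧)) ?_ ?_ ?_)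
        · change m₁ ≫ 𝟙 _ = 𝟙 _ ≫ m₁
          simp
        · change (-((-a)⟦(1 : ℤ)⟧')) ≫ 𝟙 _ = 𝟙 _ ≫ m₃
          simp [ha]
        · change (-((-b)⟦(1 : ℤ)⟧')) ≫ (𝟙 (s j))⟦(1 : ℤ)⟧' = 𝟙 _ ≫ m₂
          simp [hb]

/-- If `g : Y ⟶ s j` is nonzero, so is `r ≫ g`, and the fibre of `g` is a summand of the shorter
fibre of `r ≫ g`. If there is no such `g`, then Y is zero. -/
lemma extensionClosure_of_retract [IsTriangulated C] {X Y : C} (hX : extensionClosure s X)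
    (i : Y ⟶ X) (r : X ⟶ Y) (hir : i ≫ r = 𝟙 Y) : extensionClosure s Y := by
  obtain ⟨m, hm⟩ := hX
  induction m generalizing X Y with
  | zero =>
    refine extensionClosure_of_isZero ((IsZero.iff_id_eq_zero _).2 ?_)
    rw [← hir, IsZero.eq_of_src hm r 0, comp_zero]
  | succ m ih =>
    by_cases h : ∀ j (f : Y ⟶ s j), f = 0
    · refine extensionClosure_of_isZero ((IsZero.iff_id_eq_zero _).2 ?_)
      rw [← hir, hom_eq_zero_of_hom_simples_eq_zero h ⟨_, hm⟩ i, zero_comp]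
    · push Not at h
      obtain ⟨j, g, hg⟩ := h
      have hrg : r ≫ g ≠ 0 := by
        intro h0
        apply hg
        rw [← Category.id_comp g, ← hir, Category.assoc, h0, comp_zero]
      obtain ⟨m', Z, f, h, hm', hT, hZ⟩ := hs.exists_fibre_of_ne_zero hm _ hrg
      obtain rfl : m = m' := by omega
      obtain ⟨Z', f', h', hT'⟩ := distinguished_cocone_triangle₁ g
      obtain ⟨a, ha, ha'⟩ := triangle_map₁ hT' hT i (𝟙 _) (by
        rw [← Category.assoc, hir, Category.comp_id, Category.id_comp])
      obtain ⟨b, hb, hb'⟩ := triangle_map₁ hT hT' r (𝟙 _) (Category.comp_id _)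
      -- Induced morphisms of fibres are not unique, so `a ≫ b` need not be the identity; it is an
      -- automorphism, whose inverse corrects the retraction.
      have : IsIso (a ≫ b) := by
        refine triangle_isIso₁ hT' hT' (a ≫ b) (𝟙 _) (𝟙 _) ?_ ?_ ?_
        · rw [Category.assoc, ← hb, ← Category.assoc, ← ha, Category.assoc, hir]
        · simp
        · rw [Functor.map_comp, ← Category.assoc, ha', Category.id_comp, hb']
      have hZ' : extensionClosure s Z' := ih a (b ≫ inv (a ≫ b)) (by
        rw [← Category.assoc, IsIso.hom_inv_id]) hZ
      exact extensionClosure_extension hT' hZ' (mem_extensionClosure s j)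

end IsOrthogonalCollection

end Triangulated

/-- Fitting's lemma for an element of a finite dimensional algebra. -/
lemma exists_fitting_idempotent (k : Type*) {A : Type*} [Field k] [Ring A] [Algebra k A]
    [FiniteDimensional k A] (x : A) :
    ∃ (N : ℕ) (y : A), Commute x y ∧ IsIdempotentElem (x ^ (N + 1) * y) ∧
      x ^ (N + 1) * y * x ^ (N + 1) = x ^ (N + 1) := by
  -- The subalgebra generated by `x` is commutative and Artinian, so the ideals generated by powers
  -- of `x` stabilise, and the resulting `y` commutes with `x`.
  let R := Algebra.adjoin k {x}
  have : IsMulCommutative R := Algebra.isMulCommutative_adjoin k (by simp)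
  have : IsArtinianRing R := IsArtinianRing.of_finite k R
  let z : R := ⟨x, Algebra.self_mem_adjoin_singleton k x⟩
  obtain ⟨N, y, hy⟩ := IsArtinian.exists_pow_succ_smul_dvd z (1 : R)
  have h1 : z ^ (N + 1) * (z * y) = z ^ (N + 1) := by
    simp only [smul_eq_mul, mul_one] at hy
    rw [pow_succ', mul_assoc, ← mul_assoc (z ^ N), ← pow_succ, hy]
  have h2 : ∀ j, z ^ (N + 1) * (z * y) ^ j = z ^ (N + 1) := fun j => by
    induction j with
    | zero => simp
    | succ j ih => rw [pow_succ (z * y), ← mul_assoc, ih, h1]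
  refine ⟨N, (y ^ (N + 1) : R), congrArg Subtype.val (mul_comm z (y ^ (N + 1))), ?_, ?_⟩
  · have : z ^ (N + 1) * y ^ (N + 1) * (z ^ (N + 1) * y ^ (N + 1)) = z ^ (N + 1) * y ^ (N + 1) := by
      have h3 := h2 (N + 1)
      rw [mul_pow] at h3
      rw [mul_right_comm, h3]
    exact congrArg Subtype.val this
  · have : z ^ (N + 1) * y ^ (N + 1) * z ^ (N + 1) = z ^ (N + 1) := by
      rw [← mul_pow, mul_comm, h2]
    exact congrArg Subtype.val this

lemma exists_idempotent_of_not_isUnit (k : Type*) {A : Type*} [Field k] [Ring A] [Algebra k A]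
    [FiniteDimensional k A] (h : A) (hu : ¬ IsUnit h) :
    ∃ (N : ℕ) (e : A), IsIdempotentElem e ∧ e * h ^ N = h ^ N ∧ e ≠ 1 := by
  obtain ⟨N, y, hc, he, hN⟩ := exists_fitting_idempotent k h
  refine ⟨N + 1, _, he, hN, fun h1 => hu ?_⟩
  have h2 : h * (h ^ N * y) = 1 := by rw [← mul_assoc, ← pow_succ', h1]
  exact ⟨⟨h, h ^ N * y, h2, ((Commute.refl h).pow_right N |>.mul_right hc).eq ▸ h2⟩, rfl⟩

/-! ### Minimal approximations -/

section Envelope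

variable {k : Type w} [Field k] {C : Type u} [Category.{v} C] [Preadditive C] [Linear k C]
  [∀ X Y : C, FiniteDimensional k (X ⟶ Y)] [IsIdempotentComplete C]

include k in
/-- In a Hom-finite category with split idempotents, a left approximation can be made minimal. -/
lemma hasEnvelope_of_approximation (P : ObjectProperty C)
    (hP : ∀ ⦃X Y : C⦄ (i : Y ⟶ X) (r : X ⟶ Y), i ≫ r = 𝟙 Y → P X → P Y) {X Y : C} (f : X ⟶ Y)
    (hY : P Y) (hf : ∀ Z, P Z → ∀ g : X ⟶ Z, ∃ h : Y ⟶ Z, f ≫ h = g) : HasEnvelope P X := by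
  -- When minimality fails, a proper summand of `Y` already suffices, and its endomorphism algebra
  -- has smaller dimension.
  induction hd : Module.finrank k (Y ⟶ Y) using Nat.strong_induction_on generalizing Y with
  | _ d ih =>
  by_cases hmin : ∀ h : Y ⟶ Y, f ≫ h = f → IsIso h
  · exact ⟨Y, f, hY, hf, hmin⟩
  push Not at hmin
  obtain ⟨h, hfh, hh⟩ := hmin
  have : FiniteDimensional k (End Y) := inferInstanceAs (FiniteDimensional k (Y ⟶ Y))
  obtain ⟨N, e, he, heh, he1⟩ := exists_idempotent_of_not_isUnit k (A := End Y) h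
    (fun hu => hh ((isUnit_iff_isIso h).1 hu))
  have hpow : ∀ j : ℕ, f ≫ ((show End Y from h) ^ j : End Y) = f := fun j => by
    induction j with
    | zero => exact Category.comp_id f
    | succ j ih =>
      rw [pow_succ, End.mul_def, ← Category.assoc]
      exact (congrArg (· ≫ _) hfh).trans ih
  have hfe : f ≫ e = f := by
    have h1 : f ≫ (e * (show End Y from h) ^ N : End Y) = f := by rw [heh, hpow]
    rw [End.mul_def, ← Category.assoc] at h1
    rwa [hpow] at h1
  obtain ⟨Y', i, r, hir, hri⟩ := IsIdempotentComplete.idempotents_split Y e he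
  refine ih (Module.finrank k (Y' ⟶ Y')) ?_ (f ≫ r) (hP i r hir hY) ?_ rfl
  · let φ : (Y' ⟶ Y') →ₗ[k] (Y ⟶ Y) := Linear.rightComp k Y i ∘ₗ Linear.leftComp k Y' r
    have hφ : ∀ a, φ a = (r ≫ a) ≫ i := fun _ => rfl
    have hinj : Function.Injective φ := by
      intro a b hab
      have := congrArg (fun c => i ≫ c ≫ r) hab
      simp only [hφ, Category.assoc, hir, Category.comp_id] at this
      rwa [← Category.assoc, ← Category.assoc, hir, Category.id_comp, Category.id_comp] at this
    rw [← hd, ← LinearMap.finrank_range_of_inj hinj]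
    -- The idempotent `e` fixes the image of `φ`, so a surjective `φ` would force `e = 1`.
    refine Submodule.finrank_lt (fun htop => he1 ?_)
    obtain ⟨a, ha⟩ := LinearMap.range_eq_top.1 htop (𝟙 Y)
    rw [hφ, Category.assoc] at ha
    calc e = (r ≫ i) ≫ 𝟙 Y := by rw [hri, Category.comp_id]
      _ = 𝟙 Y := by
        rw [← ha, Category.assoc, ← Category.assoc i, hir, Category.id_comp]
  · intro Z hZ g
    obtain ⟨a, ha⟩ := hf Z hZ g
    refine ⟨i ≫ a, ?_⟩
    rw [Category.assoc, ← Category.assoc r, hri, ← Category.assoc, hfe, ha]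

end Envelope

/-! ### Part (a): envelopes for simple minded systems -/

section Triangulated

variable {C : Type u} [Category.{v} C] [HasZeroObject C] [HasShift C ℤ] [Preadditive C]
  [∀ n : ℤ, (shiftFunctor C n).Additive]

omit [HasZeroObject C] in
lemma shift_hom_shift_eq_zero {X Y : C} (a b c : ℤ) (hc : b = c + a)
    (h : ∀ f : X ⟶ Y⟦c⟧, f = 0) (f : X⟦a⟧ ⟶ Y⟦b⟧) : f = 0 := by
  obtain ⟨g, hg⟩ := (shiftFunctor C a).map_surjective
    (f ≫ ((shiftFunctorAdd' C c a b hc.symm).app Y).hom)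
  rw [h g, Functor.map_zero] at hg
  rw [← cancel_mono ((shiftFunctorAdd' C c a b hc.symm).app Y).hom, ← hg, zero_comp]

omit [HasZeroObject C] [∀ n : ℤ, (shiftFunctor C n).Additive] in
lemma shift_shift_hom_eq_zero {X Z : C} (a b c : ℤ) (hc : c = a + b)
    (h : ∀ f : X⟦c⟧ ⟶ Z, f = 0) (f : X⟦a⟧⟦b⟧ ⟶ Z) : f = 0 := by
  rw [← cancel_epi ((shiftFunctorAdd' C a b c hc.symm).app X).hom, comp_zero]
  exact h _

variable [Pretriangulated C] {n : ℕ} {s : Fin n → C}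

lemma suspend_of_retract [IsTriangulated C] (hs : IsOrthogonalCollection 2 s) (a : ℤ)
    ⦃X Y : C⦄ (i : Y ⟶ X) (r : X ⟶ Y) (hir : i ≫ r = 𝟙 Y)
    (hX : suspend (extensionClosure s) a X) : suspend (extensionClosure s) a Y := by
  obtain ⟨X', hX', ⟨e⟩⟩ := hX
  refine ⟨Y⟦-a⟧, ?_, ⟨(shiftNegShift Y a).symm⟩⟩
  refine hs.extensionClosure_of_retract hX'
    (i⟦-a⟧' ≫ e.hom⟦-a⟧' ≫ (shiftShiftNeg X' a).hom)
    ((shiftShiftNeg X' a).inv ≫ e.inv⟦-a⟧' ≫ r⟦-a⟧') ?_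
  simp only [Category.assoc, Iso.hom_inv_id_assoc]
  simp only [← Functor.map_comp, e.hom_inv_id_assoc, hir]
  exact (shiftFunctor C (-a)).map_id Y

/-- With E the closure, morphisms from the layer Σ⁻ᵐE, suspended w + 1 times, to ΣE are morphisms
from E to Σᵐ⁻ʷE. For 0 ≤ m < w the degree m - w lies in the range covered by (w + 1)-orthogonality.
-/
lemma negativeChain_shift_hom_eq_zero {w : ℕ} (hs : IsOrthogonalCollection (w + 1) s) {m : ℕ}
    (hm : m ≤ w) {A : C} (hA : negativeChain (extensionClosure s) m A) {Z : C}
    (hZ : suspend (extensionClosure s) 1 Z) (f : A⟦(w + 1 : ℤ)⟧ ⟶ Z) : f = 0 := by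
  induction m generalizing A with
  | zero => exact ((shiftFunctor C (w + 1 : ℤ)).map_isZero hA).eq_of_src _ _
  | succ m ih =>
    obtain ⟨A', B, a, b, c, hT, hA', B', hB', ⟨e⟩⟩ := hA
    obtain ⟨Z', hZ', ⟨e'⟩⟩ := hZ
    obtain ⟨g, hg⟩ : ∃ g : B⟦(w + 1 : ℤ)⟧ ⟶ Z,
        f = (((w + 1 : ℤ)).negOnePow • b⟦(w + 1 : ℤ)⟧') ≫ g :=
      Triangle.yoneda_exact₂ _ (Triangle.shift_distinguished _ hT (w + 1 : ℤ)) f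
        (ih (by omega) hA' _)
    suffices g = 0 by rw [hg, this, comp_zero]
    rw [← cancel_epi (e.inv⟦(w + 1 : ℤ)⟧'), comp_zero, ← cancel_mono e'.hom, zero_comp]
    refine shift_shift_hom_eq_zero _ _ _ rfl
      (shift_hom_shift_eq_zero _ _ (m - w : ℤ) (by ring) ?_) _
    exact hs.hom_shift_eq_zero' (by push_cast; omega) (by omega) hB' hZ'

/-- Decomposing Σ⁻ʷX instead of X moves the last layer, of degree -w + 1, to degree 1 after
suspending back. -/
lemma IsSimpleMindedSystem.exists_approximation {w : ℕ} (hw : 1 ≤ w)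
    (hs : IsSimpleMindedSystem w s) (X : C) :
    ∃ (Y : C) (f : X ⟶ Y), suspend (extensionClosure s) 1 Y ∧
      ∀ Z, suspend (extensionClosure s) 1 Z → ∀ g : X ⟶ Z, ∃ h : Y ⟶ Z, f ≫ h = g := by
  obtain ⟨w, rfl⟩ : ∃ w', w = w' + 1 := ⟨w - 1, by omega⟩
  obtain ⟨A, B, a, b, c, hT, hA, B', hB', ⟨e⟩⟩ := hs.generates (X⟦-(w + 1 : ℤ)⟧)
  let i := shiftNegShift X (w + 1 : ℤ)
  refine ⟨B⟦(w + 1 : ℤ)⟧, i.inv ≫ ((w + 1 : ℤ).negOnePow • b⟦(w + 1 : ℤ)⟧'), ⟨B', hB', ⟨?_⟩⟩, ?_⟩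
  · exact (shiftFunctor C (w + 1 : ℤ)).mapIso e ≪≫
      ((shiftFunctorAdd' C (-(w : ℤ)) (w + 1 : ℤ) 1 (by ring)).app B').symm
  · intro Z hZ g
    obtain ⟨h, hh⟩ : ∃ h : B⟦(w + 1 : ℤ)⟧ ⟶ Z, i.hom ≫ g =
        (((w + 1 : ℤ)).negOnePow • b⟦(w + 1 : ℤ)⟧') ≫ h :=
      Triangle.yoneda_exact₂ _ (Triangle.shift_distinguished _ hT (w + 1 : ℤ)) (i.hom ≫ g)
        (negativeChain_shift_hom_eq_zero hs.orthogonal le_rfl hA hZ _)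
    exact ⟨h, by rw [Category.assoc, ← hh, Iso.inv_hom_id_assoc]⟩

theorem IsSimpleMindedSystem.hasEnvelope (k : Type w) [Field k] [Linear k C]
    [∀ X Y : C, FiniteDimensional k (X ⟶ Y)] [IsIdempotentComplete C] [IsTriangulated C]
    (hs : IsOrthogonalCollection 2 s) {w : ℕ} (hw : 2 ≤ w) (hs' : IsSimpleMindedSystem w s)
    (X : C) : HasEnvelope (suspend (extensionClosure s) 1) X := by
  obtain ⟨Y, f, hY, hf⟩ := hs'.exists_approximation (by omega) X
  exact hasEnvelope_of_approximation (k := k) _ (suspend_of_retract hs 1) f hY hf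

end Triangulated

/-! ### Projective covers from envelopes -/

section Triangulated

variable {C : Type u} [Category.{v} C] [HasZeroObject C] [HasShift C ℤ] [Preadditive C]
  [∀ n : ℤ, (shiftFunctor C n).Additive] [Pretriangulated C] {n : ℕ} {s : Fin n → C}

/-- `P` is projective relative to the extensions in the extension closure. -/
def IsExtProjective (s : Fin n → C) (P : C) : Prop :=
  ∀ Y, extensionClosure s Y → ∀ f : P ⟶ Y⟦(1 : ℤ)⟧, f = 0

/-- A projective cover of `X` in the extension closure, given by a triangle
`ker ⟶ obj ⟶ X ⟶ Σ ker` with last morphism a left minimal one. -/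
structure ProjectiveCover (s : Fin n → C) (X : C) where
  obj : C
  ker : C
  ι : ker ⟶ obj
  π : obj ⟶ X
  δ : X ⟶ ker⟦(1 : ℤ)⟧
  mem_distTriang : Triangle.mk ι π δ ∈ distTriang C
  mem_ker : extensionClosure s ker
  projective : IsExtProjective s obj
  minimal : ∀ h : ker⟦(1 : ℤ)⟧ ⟶ ker⟦(1 : ℤ)⟧, δ ≫ h = δ → IsIso h

/-- Wakamatsu's lemma. -/
lemma nonempty_projectiveCover [IsTriangulated C] {X : C}
    (h : HasEnvelope (suspend (extensionClosure s) 1) X) : Nonempty (ProjectiveCover s X) := by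
  obtain ⟨Z, f, ⟨Y, hY, ⟨e⟩⟩, hf, hmin⟩ := h
  let δ : X ⟶ Y⟦(1 : ℤ)⟧ := f ≫ e.hom
  have hδ : ∀ Z, extensionClosure s Z → ∀ g : X ⟶ Z⟦(1 : ℤ)⟧,
      ∃ h : Y⟦(1 : ℤ)⟧ ⟶ Z⟦(1 : ℤ)⟧, δ ≫ h = g := by
    intro Z hZ g
    obtain ⟨h, hh⟩ := hf _ ⟨Z, hZ, ⟨Iso.refl _⟩⟩ g
    exact ⟨e.inv ≫ h, by simp [δ, hh]⟩
  have hδm : ∀ h : Y⟦(1 : ℤ)⟧ ⟶ Y⟦(1 : ℤ)⟧, δ ≫ h = δ → IsIso h := by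
    intro h hh
    have h1 : f ≫ (e.hom ≫ h ≫ e.inv) = f := by
      rw [← Category.assoc, ← Category.assoc, hh, Category.assoc, e.hom_inv_id, Category.comp_id]
    have := hmin _ h1
    have h2 : h = e.inv ≫ (e.hom ≫ h ≫ e.inv) ≫ e.hom := by simp
    rw [h2]
    infer_instance
  obtain ⟨P, ι, π, hT⟩ := distinguished_cocone_triangle₂ δ
  refine ⟨⟨P, Y, ι, π, δ, hT, hY, ?_, hδm⟩⟩
  intro Z hZ a
  -- In that case `a` factors through `π`, and the other factor through `δ`, while `π ≫ δ = 0`.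
  suffices h0 : ι ≫ a = 0 by
    obtain ⟨b, rfl⟩ := triangle_desc₂ hT a h0
    obtain ⟨c, rfl⟩ := hδ Z hZ b
    rw [← Category.assoc, triangle_comp₂₃ hT, zero_comp]
  -- View `ι ≫ a` as the class of an extension U of Y by Z. Since `δ` kills it, `δ` lifts to ΣU; as
  -- U is in the closure, this lift factors through `δ` again.
  obtain ⟨U, u, v, hU⟩ := distinguished_cocone_triangle₂ (ι ≫ a)
  have hUE : extensionClosure s U := extensionClosure_extension hU hZ hY
  have h1 : δ ≫ (ι ≫ a)⟦(1 : ℤ)⟧' = 0 := by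
    rw [Functor.map_comp, ← Category.assoc, triangle_comp₃₁ hT, zero_comp]
  obtain ⟨b, hb⟩ : ∃ b : X ⟶ U⟦(1 : ℤ)⟧, δ = b ≫ (-v⟦(1 : ℤ)⟧') :=
    triangle_lift₂ (rot_of_distTriang _ (rot_of_distTriang _ (rot_of_distTriang _
      (rot_of_distTriang _ hU)))) δ (by
        change δ ≫ (-(ι ≫ a)⟦(1 : ℤ)⟧') = 0
        rw [Preadditive.comp_neg, h1, neg_zero])
  obtain ⟨c, hc⟩ := hδ U hUE b
  -- Minimality makes the suspension of `v` a split epimorphism, and `v` composed with `ι ≫ a` is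
  -- zero.
  have hiso : IsIso (c ≫ (-v⟦(1 : ℤ)⟧')) := hδm _ (by rw [← Category.assoc, hc, ← hb])
  apply (shiftFunctor C (1 : ℤ)).map_injective
  rw [Functor.map_zero, ← cancel_epi (c ≫ (-v⟦(1 : ℤ)⟧')), comp_zero, Category.assoc,
    Preadditive.neg_comp, ← Functor.map_comp, triangle_comp₂₃ hU, Functor.map_zero, neg_zero,
    comp_zero]

lemma IsExtProjective.lift {P : C} (hP : IsExtProjective s P) {Y X Z : C} {f : Y ⟶ X} {g : X ⟶ Z}
    {h : Z ⟶ Y⟦(1 : ℤ)⟧} (hT : Triangle.mk f g h ∈ distTriang C) (hY : extensionClosure s Y)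
    (a : P ⟶ Z) : ∃ b : P ⟶ X, a = b ≫ g :=
  triangle_lift₃ hT a (hP Y hY _)

lemma IsExtProjective.biprod {P Q : C} (hP : IsExtProjective s P) (hQ : IsExtProjective s Q) :
    IsExtProjective s (P ⊞ Q) := by
  intro Y hY f
  ext
  · rw [hP Y hY (biprod.inl ≫ f), comp_zero]
  · rw [hQ Y hY (biprod.inr ≫ f), comp_zero]

namespace ProjectiveCover

variable {X : C} (Q : ProjectiveCover s X)

lemma mem_obj [IsTriangulated C] (hX : extensionClosure s X) : extensionClosure s Q.obj :=
  extensionClosure_extension Q.mem_distTriang Q.mem_ker hX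

/-- The endomorphism induced on the kernel has a suspension fixing `δ`, so minimality of the
envelope makes it invertible, and two out of three applies. -/
lemma isIso_of_comp_π (f : Q.obj ⟶ Q.obj) (hf : f ≫ Q.π = Q.π) : IsIso f := by
  obtain ⟨a, h₁, h₂⟩ := triangle_map₁ Q.mem_distTriang Q.mem_distTriang f (𝟙 X)
    (by rw [Category.comp_id, hf])
  rw [Category.id_comp] at h₂
  have := Q.minimal _ h₂
  have : IsIso a := isIso_of_reflects_iso a (shiftFunctor C (1 : ℤ))
  exact triangle_isIso₂ Q.mem_distTriang Q.mem_distTriang a f (𝟙 X) h₁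
    (by rw [Category.comp_id, hf]) (by rw [Category.id_comp, h₂])

lemma π_ne_zero (hs : IsOrthogonalCollection 2 s) {i : Fin n} (Q : ProjectiveCover s (s i)) :
    Q.π ≠ 0 := by
  intro h
  obtain ⟨r, hr⟩ := triangle_desc₃ Q.mem_distTriang (𝟙 (s i)) (by rw [h, zero_comp])
  rw [hs.shift_one_hom_eq_zero Q.mem_ker (mem_extensionClosure s i) r, comp_zero] at hr
  exact hs.id_ne_zero i hr

end ProjectiveCover

/-- An object that is projective in the extension closure and has all the projective covers of the
`s i` as retracts. -/
structure ProgeneratorData (s : Fin n → C) where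
  cover : ∀ i, ProjectiveCover s (s i)
  obj : C
  mem : extensionClosure s obj
  projective : IsExtProjective s obj
  i : ∀ i, (cover i).obj ⟶ obj
  r : ∀ i, obj ⟶ (cover i).obj
  i_r : ∀ j, i j ≫ r j = 𝟙 _

open scoped ZeroObject in
lemma nonempty_progeneratorData [IsTriangulated C]
    (h : ∀ i, HasEnvelope (suspend (extensionClosure s) 1) (s i)) :
    Nonempty (ProgeneratorData s) := by
  let Q : ∀ i, ProjectiveCover s (s i) := fun i => (nonempty_projectiveCover (h i)).some
  have key : ∀ I : Finset (Fin n), ∃ P : C, extensionClosure s P ∧ IsExtProjective s P ∧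
      ∀ j ∈ I, ∃ (i : (Q j).obj ⟶ P) (r : P ⟶ (Q j).obj), i ≫ r = 𝟙 _ := by
    intro I
    induction I using Finset.induction_on with
    | empty =>
      exact ⟨0, extensionClosure_of_isZero (isZero_zero C), fun Y _ f =>
        (isZero_zero C).eq_of_src _ _, by simp⟩
    | insert j I _ ih =>
      obtain ⟨P, hP, hP', hI⟩ := ih
      refine ⟨P ⊞ (Q j).obj, extensionClosure_biprod hP
        ((Q j).mem_obj (mem_extensionClosure s j)), hP'.biprod (Q j).projective, ?_⟩
      intro l hl
      rcases Finset.mem_insert.1 hl with rfl | hl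
      · exact ⟨biprod.inr, biprod.snd, biprod.inr_snd⟩
      · obtain ⟨i, r, hir⟩ := hI l hl
        exact ⟨i ≫ biprod.inl, biprod.fst ≫ r, by simp [hir]⟩
  obtain ⟨P, hP, hP', hI⟩ := key Finset.univ
  choose i r hir using fun j => hI j (Finset.mem_univ j)
  exact ⟨⟨Q, P, hP, hP', i, r, hir⟩⟩

end Triangulated

/-! ### Module lemmas -/

section Modules

variable {R X Q S Z M : Type*} [Ring R] [AddCommGroup X] [Module R X] [AddCommGroup Q] [Module R Q]
  [AddCommGroup S] [Module R S] [AddCommGroup Z] [Module R Z] [AddCommGroup M] [Module R M]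

lemma exists_linearMap_of_ker_le (p : X →ₗ[R] S) (hp : Function.Surjective p) (f : X →ₗ[R] M)
    (h : ∀ x, p x = 0 → f x = 0) : ∃ g : S →ₗ[R] M, ∀ x, g (p x) = f x := by
  refine ⟨(LinearMap.ker p).liftQ f (fun x hx => h x hx) ∘ₗ
    (p.quotKerEquivOfSurjective hp).symm.toLinearMap, fun x => ?_⟩
  simp only [LinearMap.comp_apply, LinearEquiv.coe_coe,
    LinearMap.quotKerEquivOfSurjective_symm_apply]
  exact Submodule.liftQ_apply _ _ _

/-- Two modules generated by the same pair of modules with the same relations are isomorphic. -/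
lemma nonempty_linearEquiv_of_coprod (u : X →ₗ[R] Z) (t : Q →ₗ[R] Z) (i : X →ₗ[R] M)
    (h : Q →ₗ[R] M) (hut : ∀ z, ∃ x q, u x + t q = z) (hih : ∀ m, ∃ x q, i x + h q = m)
    (hker : ∀ x q, u x + t q = 0 ↔ i x + h q = 0) : Nonempty (Z ≃ₗ[R] M) := by
  have h₁ : Function.Surjective (u.coprod t) := fun z => by
    obtain ⟨x, q, hxq⟩ := hut z
    exact ⟨(x, q), by simpa using hxq⟩
  have h₂ : Function.Surjective (i.coprod h) := fun z => by
    obtain ⟨x, q, hxq⟩ := hih z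
    exact ⟨(x, q), by simpa using hxq⟩
  have h₃ : LinearMap.ker (u.coprod t) = LinearMap.ker (i.coprod h) := by
    ext ⟨x, q⟩
    simpa using hker x q
  exact ⟨((u.coprod t).quotKerEquivOfSurjective h₁).symm ≪≫ₗ Submodule.quotEquivOfEq _ _ h₃ ≪≫ₗ
    (i.coprod h).quotKerEquivOfSurjective h₂⟩

end Modules

/-! ### The right modules Hom(P, X) -/

section Coyoneda

variable {C : Type u} [Category.{v} C] [Preadditive C] (P : C)

/-- Postcomposition as a linear map of right modules over the endomorphism ring. -/
def coyonedaMap {X Y : C} (f : X ⟶ Y) : (P ⟶ X) →ₗ[(End P)ᵐᵒᵖ] (P ⟶ Y) :=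
  ((preadditiveCoyonedaObj P).map f).hom

variable {P}

@[simp] lemma coyonedaMap_apply {X Y : C} (f : X ⟶ Y) (a : P ⟶ X) :
    coyonedaMap P f a = a ≫ f := rfl

lemma op_smul_hom {X : C} (a : P ⟶ P) (f : P ⟶ X) :
    MulOpposite.op (show End P from a) • f = a ≫ f := rfl

lemma linearMap_comp {X : C} {M : Type*} [AddCommGroup M] [Module (End P)ᵐᵒᵖ M]
    (G : (P ⟶ X) →ₗ[(End P)ᵐᵒᵖ] M) (a : P ⟶ P) (f : P ⟶ X) :
    G (a ≫ f) = MulOpposite.op (show End P from a) • G f := by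
  rw [← op_smul_hom, map_smul]

variable {Q : C} (i : Q ⟶ P) (r : P ⟶ Q) (hir : i ≫ r = 𝟙 Q)

/-- The linear map from `Hom(P, Q)`, where `Q` is a retract of `P`, determined by an element. -/
def linearMapOfRetract {M : Type*} [AddCommGroup M] [Module (End P)ᵐᵒᵖ M] (m : M) :
    (P ⟶ Q) →ₗ[(End P)ᵐᵒᵖ] M :=
  (LinearMap.toSpanSingleton (End P)ᵐᵒᵖ M m) ∘ₗ
    { toFun := fun b => MulOpposite.op (show End P from b ≫ i)
      map_add' := fun b c => by
        rw [Preadditive.add_comp]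
        rfl
      map_smul' := fun a b => congrArg MulOpposite.op (Category.assoc a.unop b i) }

lemma linearMapOfRetract_apply {M : Type*} [AddCommGroup M] [Module (End P)ᵐᵒᵖ M] (m : M)
    (b : P ⟶ Q) : linearMapOfRetract i m b = MulOpposite.op (show End P from b ≫ i) • m := rfl

include hir

/-- The module Hom(P, Q) is generated by `r`, because `b = (b ≫ i) ≫ r`. -/
lemma linearMap_retract_apply {M : Type*} [AddCommGroup M] [Module (End P)ᵐᵒᵖ M]
    (G : (P ⟶ Q) →ₗ[(End P)ᵐᵒᵖ] M) (b : P ⟶ Q) :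
    G b = MulOpposite.op (show End P from b ≫ i) • G r := by
  rw [← linearMap_comp, Category.assoc, hir, Category.comp_id]

lemma exists_hom_of_linearMap_retract {Z : C} (G : (P ⟶ Q) →ₗ[(End P)ᵐᵒᵖ] (P ⟶ Z)) :
    ∃ q : Q ⟶ Z, ∀ b, G b = b ≫ q :=
  ⟨i ≫ G r, fun b => by
    rw [linearMap_retract_apply i r hir G b, op_smul_hom, Category.assoc]⟩

end Coyoneda

/-! ### Hom(P, -) is faithful, full and dense -/

section Triangulated

variable {C : Type u} [Category.{v} C] [HasZeroObject C] [HasShift C ℤ] [Preadditive C]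
  [∀ n : ℤ, (shiftFunctor C n).Additive] [Pretriangulated C] {n : ℕ} {s : Fin n → C}

namespace ProgeneratorData

variable (D : ProgeneratorData s) (hs : IsOrthogonalCollection 2 s)
include hs

lemma r_π_ne_zero (j : Fin n) : D.r j ≫ (D.cover j).π ≠ 0 := by
  intro h
  apply (D.cover j).π_ne_zero hs
  rw [← Category.id_comp (D.cover j).π, ← D.i_r, Category.assoc, h, comp_zero]

/-- Faithfulness. A nonzero composite X → `s j` would let the nonzero morphism from P to `s j` lift
through it, contradicting `hf`; so `f` descends to the smaller subobject Y. -/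
lemma eq_zero_of_forall_comp {X Z : C} (hX : extensionClosure s X) (hZ : extensionClosure s Z)
    (f : X ⟶ Z) (hf : ∀ a : D.obj ⟶ X, a ≫ f = 0) : f = 0 := by
  revert f
  refine extensionClosure_induction (motive := fun Z => ∀ f : X ⟶ Z,
    (∀ a : D.obj ⟶ X, a ≫ f = 0) → f = 0) ?_ ?_ hZ
  · exact fun Z hZ f _ => hZ.eq_of_tgt _ _
  · intro Z Y j u g h hT hY ih f hf
    have hfg : f ≫ g = 0 := by
      by_contra hne
      obtain ⟨b, hb⟩ := hs.lift_of_ne_zero hX D.projective (f ≫ g) hne (D.r j ≫ (D.cover j).π)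
      apply D.r_π_ne_zero hs j
      rw [← hb, ← Category.assoc, hf, zero_comp]
    obtain ⟨f', rfl⟩ := triangle_lift₂ hT f hfg
    rw [ih f' fun a => hs.comp_left_cancel hT D.mem (mem_extensionClosure s j)
      (by rw [Category.assoc, hf]), zero_comp]

/-- Fullness, by induction on a filtration of X. The projective cover of `s j` maps to X over `s j`
and, with Y, generates everything that P sees in X, so `G` is tested on these two pieces. -/
lemma exists_hom_of_linearMap [IsTriangulated C] {X Z : C} (hX : extensionClosure s X)
    (hZ : extensionClosure s Z) (G : (D.obj ⟶ X) →ₗ[(End D.obj)ᵐᵒᵖ] (D.obj ⟶ Z)) :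
    ∃ f : X ⟶ Z, ∀ a, G a = a ≫ f := by
  revert G
  refine extensionClosure_induction (motive := fun X => ∀ G : (D.obj ⟶ X) →ₗ[(End D.obj)ᵐᵒᵖ]
    (D.obj ⟶ Z), ∃ f : X ⟶ Z, ∀ a, G a = a ≫ f) ?_ ?_ hX
  · intro X hX G
    refine ⟨0, fun a => ?_⟩
    rw [hX.eq_of_tgt a 0, map_zero, zero_comp]
  · intro X Y j u v d hT hY ih G
    let Q := D.cover j
    have hQ : extensionClosure s Q.obj := Q.mem_obj (mem_extensionClosure s j)
    obtain ⟨f', hf'⟩ := ih (G ∘ₗ coyonedaMap D.obj u)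
    replace hf' : ∀ b : D.obj ⟶ Y, G (b ≫ u) = b ≫ f' := hf'
    obtain ⟨t, ht⟩ := Q.projective.lift hT hY Q.π
    obtain ⟨κ, hκ, hκ'⟩ := triangle_map₁ Q.mem_distTriang hT t (𝟙 _)
      (by rw [Category.comp_id, ht])
    rw [Category.id_comp] at hκ'
    -- `f'` extends to `X`
    obtain ⟨q, hq⟩ := exists_hom_of_linearMap_retract _ _ (D.i_r j) (G ∘ₗ coyonedaMap D.obj t)
    replace hq : ∀ b : D.obj ⟶ Q.obj, G (b ≫ t) = b ≫ q := hq
    have h₁ : κ ≫ f' = Q.ι ≫ q := by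
      rw [← sub_eq_zero]
      refine D.eq_zero_of_forall_comp hs Q.mem_ker hZ _ fun b => ?_
      rw [Preadditive.comp_sub, sub_eq_zero, ← Category.assoc, ← hf', Category.assoc, ← hκ,
        ← Category.assoc, hq, Category.assoc]
    -- The obstruction to extending `f'` is `d` followed by its suspension. As `d` is `δ` followed
    -- by the suspension of `κ`, and `κ ≫ f'` factors through `ι`, it vanishes.
    obtain ⟨f, hf⟩ := triangle_desc₁ hT f' (by
      rw [← hκ', Category.assoc, ← Functor.map_comp, h₁, Functor.map_comp, ← Category.assoc,
        triangle_comp₃₁ Q.mem_distTriang, zero_comp])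
    -- the difference factors through `s j`
    let G' := G - coyonedaMap D.obj f
    have hG' : ∀ b : D.obj ⟶ Y, G' (b ≫ u) = 0 := fun b => by
      change G (b ≫ u) - (b ≫ u) ≫ f = 0
      rw [hf', hf, Category.assoc, sub_self]
    obtain ⟨q', hq'⟩ := exists_hom_of_linearMap_retract _ _ (D.i_r j) (G' ∘ₗ coyonedaMap D.obj t)
    replace hq' : ∀ b : D.obj ⟶ Q.obj, G' (b ≫ t) = b ≫ q' := hq'
    obtain ⟨f'', hf''⟩ := triangle_desc₂ Q.mem_distTriang q'
      (D.eq_zero_of_forall_comp hs Q.mem_ker hZ _ fun b => by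
        rw [← Category.assoc, ← hq', Category.assoc, hκ, ← Category.assoc, hG'])
    refine ⟨f + v ≫ f'', fun a => ?_⟩
    obtain ⟨b, hb⟩ := D.projective.lift Q.mem_distTriang Q.mem_ker (a ≫ v)
    obtain ⟨c, hc⟩ := triangle_lift₂ hT (a - b ≫ t) (by
      rw [Preadditive.sub_comp, Category.assoc, ← ht, hb, sub_self])
    have h₂ : G' a = a ≫ v ≫ f'' := by
      have : a = c ≫ u + b ≫ t := by rw [← hc, sub_add_cancel]
      have h₃ : G' a = b ≫ q' := by rw [this, map_add, hG', zero_add, hq']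
      rw [h₃, hf'', ← Category.assoc, ← Category.assoc, hb]
    have h₄ : G a - a ≫ f = a ≫ v ≫ f'' := h₂
    rw [Preadditive.comp_add, ← h₄, add_sub_cancel]

lemma isSimpleModule (j : Fin n) : IsSimpleModule (End D.obj)ᵐᵒᵖ (D.obj ⟶ s j) := by
  rw [isSimpleModule_iff_toSpanSingleton_surjective]
  refine ⟨⟨_, _, D.r_π_ne_zero hs j⟩, fun g hg a => ?_⟩
  obtain ⟨b, hb⟩ := hs.lift_of_ne_zero D.mem D.projective g hg a
  exact ⟨MulOpposite.op (show End D.obj from b), hb⟩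

/-- A nonzero map from Hom(P, X) to T is nonzero on Hom(P, Y) or factors through the simple module
Hom(P, `s j`), where Schur's lemma applies. It starts from X = P. -/
lemma exists_linearEquiv_of_isSimpleModule {T : Type*} [AddCommGroup T] [Module (End D.obj)ᵐᵒᵖ T]
    [IsSimpleModule (End D.obj)ᵐᵒᵖ T] :
    ∃ j, Nonempty ((D.obj ⟶ s j) ≃ₗ[(End D.obj)ᵐᵒᵖ] T) := by
  suffices key : ∀ X, extensionClosure s X → ∀ G : (D.obj ⟶ X) →ₗ[(End D.obj)ᵐᵒᵖ] T, G ≠ 0 →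
      ∃ j, Nonempty ((D.obj ⟶ s j) ≃ₗ[(End D.obj)ᵐᵒᵖ] T) by
    have := IsSimpleModule.nontrivial (End D.obj)ᵐᵒᵖ T
    obtain ⟨t, ht⟩ := exists_ne (0 : T)
    refine key D.obj D.mem (linearMapOfRetract (𝟙 _) t) fun h => ht ?_
    have h1 := LinearMap.congr_fun h (𝟙 D.obj)
    rw [linearMapOfRetract_apply, Category.comp_id] at h1
    exact (one_smul (End D.obj)ᵐᵒᵖ t).symm.trans h1
  intro X hX
  refine extensionClosure_induction (motive := fun X => ∀ G : (D.obj ⟶ X) →ₗ[(End D.obj)ᵐᵒᵖ] T,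
    G ≠ 0 → ∃ j, Nonempty ((D.obj ⟶ s j) ≃ₗ[(End D.obj)ᵐᵒᵖ] T)) ?_ ?_ hX
  · intro X hX G hG
    refine (hG (LinearMap.ext fun a => ?_)).elim
    rw [hX.eq_of_tgt a 0, map_zero, map_zero]
  · intro X Y j u v d hT hY ih G hG
    by_cases h : G ∘ₗ coyonedaMap D.obj u = 0
    · obtain ⟨g, hg⟩ := exists_linearMap_of_ker_le (coyonedaMap D.obj v)
        (fun a => by
          obtain ⟨b, hb⟩ := D.projective.lift hT hY a
          exact ⟨b, hb.symm⟩) G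
        (fun a ha => by
          obtain ⟨b, rfl⟩ := triangle_lift₂ hT a ha
          exact LinearMap.congr_fun h b)
      have := D.isSimpleModule hs j
      refine ⟨j, ⟨LinearEquiv.ofBijective g (LinearMap.bijective_of_ne_zero ?_)⟩⟩
      rintro rfl
      exact hG (LinearMap.ext fun a => (hg a).symm)
    · exact ih _ h

/-- Density for one extension step. The cover of `s j` maps to M over `s j`; on its kernel this is,
by fullness, a morphism `κ` to X. Pushing the cover out along `κ` gives Z, and both Hom(P, Z) and M
are that pushout of modules. -/
lemma exists_linearEquiv_of_extension [IsTriangulated C] {M : Type*} [AddCommGroup M]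
    [Module (End D.obj)ᵐᵒᵖ M] {X : C} (hX : extensionClosure s X) (j : Fin n)
    (i : (D.obj ⟶ X) →ₗ[(End D.obj)ᵐᵒᵖ] M) (hi : Function.Injective i)
    (p : M →ₗ[(End D.obj)ᵐᵒᵖ] (D.obj ⟶ s j)) (hp : Function.Surjective p)
    (hpi : ∀ m, p m = 0 ↔ m ∈ LinearMap.range i) :
    ∃ Z, extensionClosure s Z ∧ Nonempty ((D.obj ⟶ Z) ≃ₗ[(End D.obj)ᵐᵒᵖ] M) := by
  let Q := D.cover j
  obtain ⟨m, hm⟩ := hp (D.r j ≫ Q.π)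
  let H : (D.obj ⟶ Q.obj) →ₗ[(End D.obj)ᵐᵒᵖ] M := linearMapOfRetract (D.i j) m
  have hpH : ∀ b, p (H b) = b ≫ Q.π := fun b => by
    rw [linearMapOfRetract_apply, map_smul, hm, op_smul_hom, Category.assoc,
      ← Category.assoc (D.i j), D.i_r, Category.id_comp]
  have hrange : ∀ c : D.obj ⟶ Q.ker, H (c ≫ Q.ι) ∈ LinearMap.range i := fun c => by
    rw [← hpi, hpH, Category.assoc, triangle_comp₁₂ Q.mem_distTriang, comp_zero]
  let K : (D.obj ⟶ Q.ker) →ₗ[(End D.obj)ᵐᵒᵖ] (D.obj ⟶ X) :=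
    (LinearEquiv.ofInjective i hi).symm.toLinearMap ∘ₗ
      (H ∘ₗ coyonedaMap D.obj Q.ι).codRestrict (LinearMap.range i) hrange
  have hK : ∀ c, i (K c) = H (c ≫ Q.ι) := fun c =>
    congrArg Subtype.val ((LinearEquiv.ofInjective i hi).apply_symm_apply ⟨_, hrange c⟩)
  obtain ⟨κ, hκ⟩ := D.exists_hom_of_linearMap hs Q.mem_ker hX K
  replace hκ : ∀ c, i (c ≫ κ) = H (c ≫ Q.ι) := fun c => by rw [← hκ, hK]
  obtain ⟨Z, u, v, hT⟩ := distinguished_cocone_triangle₂ (Q.δ ≫ κ⟦(1 : ℤ)⟧')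
  obtain ⟨t, ht, ht'⟩ := triangle_map₂ Q.mem_distTriang hT κ (𝟙 _) (Category.id_comp _).symm
  rw [Category.comp_id] at ht'
  refine ⟨Z, extensionClosure_extension hT hX (mem_extensionClosure s j),
    nonempty_linearEquiv_of_coprod (coyonedaMap D.obj u) (coyonedaMap D.obj t) i H ?_ ?_ ?_⟩
  · intro a
    obtain ⟨b, hb⟩ := D.projective.lift Q.mem_distTriang Q.mem_ker (a ≫ v)
    obtain ⟨c, hc⟩ := triangle_lift₂ hT (a - b ≫ t) (by
      rw [Preadditive.sub_comp, Category.assoc, ← ht', hb, sub_self])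
    exact ⟨c, b, by rw [coyonedaMap_apply, ← hc, coyonedaMap_apply, sub_add_cancel]⟩
  · intro m'
    obtain ⟨b, hb⟩ := D.projective.lift Q.mem_distTriang Q.mem_ker (p m')
    obtain ⟨x, hx⟩ := (hpi (m' - H b)).1 (by rw [map_sub, hpH, hb, sub_self])
    exact ⟨x, b, by rw [hx, sub_add_cancel]⟩
  · intro x b
    simp only [coyonedaMap_apply]
    constructor
    · intro h
      have h1 : b ≫ Q.π = 0 := by
        have := congrArg (· ≫ v) h
        simpa only [Preadditive.add_comp, Category.assoc, triangle_comp₁₂ hT, comp_zero, zero_add,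
          ← ht', zero_comp] using this
      obtain ⟨c, rfl⟩ := triangle_lift₂ Q.mem_distTriang b h1
      have h2 : x + c ≫ κ = 0 := hs.comp_left_cancel hT D.mem (mem_extensionClosure s j) (by
        rw [Preadditive.add_comp, Category.assoc, ← ht, ← Category.assoc, h])
      rw [← hκ, ← map_add, h2, map_zero]
    · intro h
      have h1 : b ≫ Q.π = 0 := by
        have := congrArg p h
        rwa [map_add, (hpi (i x)).2 ⟨x, rfl⟩, zero_add, hpH, map_zero] at this
      obtain ⟨c, rfl⟩ := triangle_lift₂ Q.mem_distTriang b h1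
      rw [← hκ, ← map_add, map_eq_zero_iff i hi] at h
      rw [Category.assoc, ht, ← Category.assoc, ← Preadditive.add_comp, h, zero_comp]

lemma exists_linearEquiv_of_isFiniteLength [IsTriangulated C] {M : Type*} [AddCommGroup M]
    [Module (End D.obj)ᵐᵒᵖ M] (hM : IsFiniteLength (End D.obj)ᵐᵒᵖ M) :
    ∃ X, extensionClosure s X ∧ Nonempty ((D.obj ⟶ X) ≃ₗ[(End D.obj)ᵐᵒᵖ] M) := by
  induction hM with
  | @of_subsingleton M _ _ _ =>
    obtain ⟨X, hX⟩ := HasZeroObject.zero (C := C)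
    have : Subsingleton (D.obj ⟶ X) := ⟨fun a b => hX.eq_of_tgt a b⟩
    exact ⟨X, extensionClosure_of_isZero hX, ⟨0⟩⟩
  | @of_simple_quotient M _ _ N _ _ ih =>
    obtain ⟨X, hX, ⟨e⟩⟩ := ih
    obtain ⟨j, ⟨e'⟩⟩ := D.exists_linearEquiv_of_isSimpleModule hs (T := M ⧸ N)
    refine D.exists_linearEquiv_of_extension hs hX j (N.subtype ∘ₗ e.toLinearMap)
      (N.injective_subtype.comp e.injective) (e'.symm.toLinearMap ∘ₗ N.mkQ)
      (e'.symm.surjective.comp N.mkQ_surjective) fun m => ?_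
    simp only [LinearMap.comp_apply, LinearEquiv.coe_coe, LinearEquiv.map_eq_zero_iff,
      Submodule.mkQ_apply, Submodule.Quotient.mk_eq_zero, LinearMap.range_comp,
      LinearEquiv.range, Submodule.map_top, Submodule.range_subtype]

end ProgeneratorData

end Triangulated

/-! ### Part (b)(i): the equivalence -/

section ModuleCategory

lemma fgModuleCat_smul_apply {k : Type*} [Field k] {A : Type*} [Ring A] [Algebra k A]
    {M N : FGModuleCat.{v} A} (c : k) (φ : M ⟶ N) (x : M) :
    (c • φ).hom.hom x = algebraMap k A c • φ.hom.hom x := rfl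

variable {k : Type w} [Field k]
  {C : Type u} [Category.{v} C] [HasZeroObject C] [HasShift C ℤ] [Preadditive C]
  [∀ n : ℤ, (shiftFunctor C n).Additive] [Pretriangulated C]
  [Linear k C] {n : ℕ} {s : Fin n → C}

omit [HasZeroObject C] [HasShift C ℤ] [∀ n : ℤ, (shiftFunctor C n).Additive]
  [Pretriangulated C] in
lemma isScalarTower_hom (P X : C) : IsScalarTower k (End P)ᵐᵒᵖ (P ⟶ X) :=
  ⟨fun c a f => Linear.smul_comp P P X c a.unop f⟩

omit [HasZeroObject C] [HasShift C ℤ] [∀ n : ℤ, (shiftFunctor C n).Additive]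
  [Pretriangulated C] in
variable (k) in
lemma finite_hom [∀ X Y : C, FiniteDimensional k (X ⟶ Y)] (P X : C) :
    Module.Finite (End P)ᵐᵒᵖ (P ⟶ X) :=
  have := isScalarTower_hom (k := k) P X
  Module.Finite.of_restrictScalars_finite k (End P)ᵐᵒᵖ (P ⟶ X)

/-- The functor `Hom(P, -)` on the extension closure. -/
def ProgeneratorData.functor (D : ProgeneratorData s)
    (h : ∀ X, Module.Finite (End D.obj)ᵐᵒᵖ (D.obj ⟶ X)) :
    (extensionClosure s).FullSubcategory ⥤ FGModuleCat.{v} (End D.obj)ᵐᵒᵖ :=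
  (ModuleCat.isFG (End D.obj)ᵐᵒᵖ).lift
    ((extensionClosure s).ι ⋙ preadditiveCoyonedaObj D.obj) fun X => h X.obj

variable [∀ X Y : C, FiniteDimensional k (X ⟶ Y)] [IsTriangulated C]

theorem exists_equivalence (hs : IsOrthogonalCollection 2 s)
    (h : ∀ X, extensionClosure s X → HasEnvelope (suspend (extensionClosure s) 1) X) :
    ∃ (A : Type v) (_ : Ring A) (_ : Algebra k A), FiniteDimensional k A ∧
      ∃ F : (extensionClosure s).FullSubcategory ≌ FGModuleCat.{v} Aᵐᵒᵖ,
        F.functor.Linear k := by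
  obtain ⟨D⟩ := nonempty_progeneratorData fun i => h _ (mem_extensionClosure s i)
  have hfin : FiniteDimensional k (End D.obj) :=
    inferInstanceAs (FiniteDimensional k (D.obj ⟶ D.obj))
  refine ⟨End D.obj, inferInstance, inferInstance, hfin, ?_⟩
  let F := D.functor fun X => finite_hom k D.obj X
  have : F.Faithful := ⟨fun {X Y} f g hfg => by
    apply ObjectProperty.hom_ext
    rw [← sub_eq_zero]
    refine D.eq_zero_of_forall_comp hs X.property Y.property _ fun a => ?_
    rw [Preadditive.comp_sub, sub_eq_zero]
    exact LinearMap.congr_fun (congrArg (fun φ => φ.hom.hom) hfg) a⟩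
  have : F.Full := ⟨fun {X Y} G => by
    obtain ⟨f, hf⟩ := D.exists_hom_of_linearMap hs X.property Y.property G.hom.hom
    exact ⟨ObjectProperty.homMk f, FGModuleCat.hom_ext (LinearMap.ext fun a => (hf a).symm)⟩⟩
  have : F.EssSurj := ⟨fun M => by
    have : IsArtinianRing (End D.obj)ᵐᵒᵖ := IsArtinianRing.of_finite k _
    have : IsNoetherianRing (End D.obj)ᵐᵒᵖ := IsNoetherianRing.of_finite k _
    obtain ⟨X, hX, ⟨e⟩⟩ := D.exists_linearEquiv_of_isFiniteLength hs (M := M)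
      (isFiniteLength_iff_isNoetherian_isArtinian.2 ⟨inferInstance, inferInstance⟩)
    have := finite_hom k D.obj X
    exact ⟨⟨X, hX⟩, ⟨e.toFGModuleCatIso⟩⟩⟩
  have : F.IsEquivalence := {}
  refine ⟨F.asEquivalence, ⟨fun {X Y} f c => ?_⟩⟩
  apply FGModuleCat.hom_ext
  refine LinearMap.ext fun a => ?_
  rw [fgModuleCat_smul_apply, Algebra.algebraMap_eq_smul_one]
  have h₁ : (show D.obj ⟶ X.obj from a) ≫ (c • f.hom) =
      (c • 𝟙 D.obj) ≫ (show D.obj ⟶ X.obj from a) ≫ f.hom := by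
    rw [Linear.comp_smul, Linear.smul_comp, Category.id_comp]
  exact h₁

end ModuleCategory

/-! ### Radicals and primitive idempotents -/

section Algebra

section Jacobson

variable {R : Type*} [Ring R]

lemma mem_jacobson_of_isNilpotent_mul {x : R} (h : ∀ y, IsNilpotent (y * x)) :
    x ∈ Ring.jacobson R := by
  rw [← Ideal.jacobson_bot, Ideal.mem_jacobson_iff]
  intro y
  obtain ⟨u, hu⟩ := (h y).isUnit_one_add
  refine ⟨↑u⁻¹, ?_⟩
  have : (↑u⁻¹ : R) * (1 + y * x) = 1 := by rw [← hu, Units.inv_mul]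
  rw [mul_add, mul_one, ← mul_assoc] at this
  rw [add_comm (_ * _ * _), this, sub_self]
  exact Submodule.zero_mem _

lemma isNilpotent_of_mem_jacobson [IsArtinianRing R] {x : R} (hx : x ∈ Ring.jacobson R) :
    IsNilpotent x := by
  rw [← Ideal.jacobson_bot] at hx
  obtain ⟨N, hN⟩ := IsArtinianRing.isNilpotent_jacobson_bot (R := R)
  exact ⟨N, by simpa [hN] using Ideal.pow_mem_pow hx N⟩

/-- Over an Artinian ring the radical is a nil two-sided ideal, so the nilpotency criterion holds on
either side. -/
lemma op_mem_jacobson_iff [IsArtinianRing R] [IsArtinianRing Rᵐᵒᵖ] {x : R} :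
    MulOpposite.op x ∈ Ring.jacobson Rᵐᵒᵖ ↔ x ∈ Ring.jacobson R := by
  constructor
  · intro h
    refine mem_jacobson_of_isNilpotent_mul fun y => ?_
    obtain ⟨N, hN⟩ := isNilpotent_of_mem_jacobson
      (Ideal.mul_mem_right (MulOpposite.op y) _ h)
    exact ⟨N, by
      apply MulOpposite.op_injective
      rwa [MulOpposite.op_pow, MulOpposite.op_mul]⟩
  · intro h
    refine mem_jacobson_of_isNilpotent_mul fun y => ?_
    obtain ⟨N, hN⟩ := isNilpotent_of_mem_jacobson (Ideal.mul_mem_right y.unop _ h)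
    exact ⟨N, by
      apply MulOpposite.unop_injective
      rwa [MulOpposite.unop_pow, MulOpposite.unop_mul, MulOpposite.unop_op]⟩

/-- A module over a semiprimary ring that is killed by the Jacobson radical is semisimple. -/
lemma isSemisimpleModule_of_jacobson_le_annihilator [IsSemiprimaryRing R] {M : Type*}
    [AddCommGroup M] [Module R M] (h : ∀ r ∈ Ring.jacobson R, ∀ m : M, r • m = 0) :
    IsSemisimpleModule R M := by
  have hJ : Module.IsTorsionBySet R M (Ring.jacobson R) := fun m r => h r r.2 m
  let _ := hJ.module
  exact (hJ.semilinearMap.isSemisimpleModule_iff_of_bijective Function.bijective_id).2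
    inferInstance

lemma smul_eq_zero_of_mem_jacobson {M : Type*} [AddCommGroup M] [Module R M]
    [IsSemisimpleModule R M] {r : R} (hr : r ∈ Ring.jacobson R) (m : M) : r • m = 0 :=
  Module.mem_annihilator.1 (IsSemisimpleModule.jacobson_le_annihilator R M hr) m

end Jacobson

section RightIdeal

variable {A : Type*} [Ring A]

lemma mem_rightIdeal {e : A} (he : IsIdempotentElem e) {x : A} :
    x ∈ rightIdeal e ↔ e * x = x := by
  rw [Submodule.mem_span_singleton]
  constructor
  · rintro ⟨a, rfl⟩
    rw [MulOpposite.smul_eq_mul_unop, ← mul_assoc, he.eq]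
  · intro h
    exact ⟨MulOpposite.op x, h⟩

/-- The generator of a right ideal. -/
def rightIdealGen (e : A) : rightIdeal e := ⟨e, Submodule.mem_span_singleton_self e⟩

lemma eq_op_smul_rightIdealGen {e : A} (he : IsIdempotentElem e) (x : rightIdeal e) :
    x = MulOpposite.op (x : A) • rightIdealGen e :=
  Subtype.ext ((mem_rightIdeal he).1 x.2).symm

variable {M : Type*} [AddCommGroup M] [Module Aᵐᵒᵖ M]

/-- The linear map on a right ideal given by an element of a module. -/
def rightIdealMap (e : A) (m : M) : rightIdeal e →ₗ[Aᵐᵒᵖ] M where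
  toFun x := MulOpposite.op (x : A) • m
  map_add' x y := by
    rw [Submodule.coe_add, MulOpposite.op_add, add_smul]
  map_smul' a x := by
    rw [Submodule.coe_smul, RingHom.id_apply, ← mul_smul]
    rfl

lemma rightIdealMap_apply (e : A) (m : M) (x : rightIdeal e) :
    rightIdealMap e m x = MulOpposite.op (x : A) • m := rfl

lemma map_rightIdeal_apply {e : A} (he : IsIdempotentElem e) (f : rightIdeal e →ₗ[Aᵐᵒᵖ] M)
    (x : rightIdeal e) : f x = MulOpposite.op (x : A) • f (rightIdealGen e) := by
  rw [← map_smul, ← eq_op_smul_rightIdealGen he]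

lemma op_smul_map_rightIdealGen {e : A} (he : IsIdempotentElem e) (f : rightIdeal e →ₗ[Aᵐᵒᵖ] M) :
    MulOpposite.op e • f (rightIdealGen e) = f (rightIdealGen e) :=
  (map_rightIdeal_apply he f (rightIdealGen e)).symm

variable {N : Type*} [AddCommGroup N] [Module Aᵐᵒᵖ N]

lemma exists_rightIdeal_lift {e : A} (he : IsIdempotentElem e) (p : M →ₗ[Aᵐᵒᵖ] N)
    (hp : Function.Surjective p) (f : rightIdeal e →ₗ[Aᵐᵒᵖ] N) :
    ∃ g : rightIdeal e →ₗ[Aᵐᵒᵖ] M, ∀ x, p (g x) = f x := by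
  obtain ⟨m, hm⟩ := hp (f (rightIdealGen e))
  exact ⟨rightIdealMap e m, fun x => by
    rw [rightIdealMap_apply, map_smul, hm, map_rightIdeal_apply he f x]⟩

lemma jacobson_rightIdeal_iff [IsArtinianRing A] [IsArtinianRing Aᵐᵒᵖ] {e : A}
    (he : IsIdempotentElem e) (x : rightIdeal e) :
    x ∈ Module.jacobson Aᵐᵒᵖ (rightIdeal e) ↔ (x : A) ∈ Ring.jacobson A := by
  constructor
  · intro hx
    let φ : A →ₗ[Aᵐᵒᵖ] Aᵐᵒᵖ :=
      { toFun := MulOpposite.op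
        map_add' := fun _ _ => rfl
        map_smul' := fun _ _ => rfl }
    exact op_mem_jacobson_iff.1 (Module.le_comap_jacobson (φ ∘ₗ (rightIdeal e).subtype) hx)
  · intro hx
    rw [eq_op_smul_rightIdealGen he x]
    exact Ring.jacobson_smul_top_le Aᵐᵒᵖ _
      (Submodule.smul_mem_smul (op_mem_jacobson_iff.2 hx) Submodule.mem_top)

end RightIdeal

section Primitive

variable (k : Type*) {A : Type*} [Field k] [Ring A] [Algebra k A] [FiniteDimensional k A]

include k

/-- The ring e A e is local: the Fitting idempotent of `x` lies in it, hence is 0 or `e`. -/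
lemma IsPrimitiveIdempotent.isNilpotent_or {e : A} (he : IsPrimitiveIdempotent e) {x : A}
    (h₁ : e * x = x) (h₂ : x * e = x) : IsNilpotent x ∨ ∃ y, x * y = e := by
  obtain ⟨N, y, hc, hi, hN⟩ := exists_fitting_idempotent k x
  have h₃ : e * (x ^ (N + 1) * y) = x ^ (N + 1) * y := by
    rw [pow_succ', ← mul_assoc, ← mul_assoc, h₁]
  have h₄ : x ^ (N + 1) * y * e = x ^ (N + 1) * y := by
    rw [(hc.pow_left (N + 1)).eq, mul_assoc, pow_succ, mul_assoc (x ^ N), h₂]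
  rcases he.eq_or_eq _ hi h₃ h₄ with h | h
  · exact Or.inl ⟨N + 1, by rw [← hN, h, zero_mul]⟩
  · exact Or.inr ⟨x ^ N * y, by rw [← mul_assoc, ← pow_succ', h]⟩

/-- The right module generated by a primitive idempotent is not the sum of two proper
submodules. -/
lemma IsPrimitiveIdempotent.eq_top_or_eq_top {e : A} (he : IsPrimitiveIdempotent e)
    {U V : Submodule Aᵐᵒᵖ (rightIdeal e)} (h : U ⊔ V = ⊤) : U = ⊤ ∨ V = ⊤ := by
  have key : ∀ W : Submodule Aᵐᵒᵖ (rightIdeal e), ∀ x ∈ W, ∀ y, (x : A) * y = e → W = ⊤ := by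
    intro W x hx y hy
    rw [eq_top_iff]
    rintro z -
    rw [eq_op_smul_rightIdealGen he.idem z]
    refine W.smul_mem _ ?_
    have : rightIdealGen e = MulOpposite.op y • x := Subtype.ext hy.symm
    rw [this]
    exact W.smul_mem _ hx
  obtain ⟨u, hu, v, hv, huv⟩ := Submodule.mem_sup.1 (h ▸ Submodule.mem_top :
    rightIdealGen e ∈ U ⊔ V)
  have h₁ : (u : A) * e + v * e = e := by
    have := congrArg Subtype.val huv
    rw [← add_mul]
    change ((u : A) + v) * e = e
    rw [show (u : A) + v = e from this, he.idem.eq]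
  have hue : e * (u * e) = u * e := by rw [← mul_assoc, (mem_rightIdeal he.idem).1 u.2]
  rcases he.isNilpotent_or k hue (by rw [mul_assoc, he.idem.eq]) with hn | ⟨y, hy⟩
  · right
    obtain ⟨z, hz⟩ := hn.isUnit_one_sub.exists_right_inv
    refine key V v hv (e * (z * e)) ?_
    have h₂ : (v : A) * e = e * (1 - u * e) := by
      rw [mul_sub, mul_one, hue, eq_sub_iff_add_eq, add_comm, h₁]
    rw [← mul_assoc, h₂, mul_assoc, ← mul_assoc _ z, hz, one_mul, he.idem.eq]
  · left
    exact key U u hu (e * y) (by rw [← mul_assoc, hy])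

/-- A form of Nakayama's lemma: a submodule not inside the maximal submodule ker `p` spans e A
together with it, and e A is not a sum of two proper submodules. -/
lemma IsPrimitiveIdempotent.eq_top_of_surjective {e : A} (he : IsPrimitiveIdempotent e)
    {T : Type*} [AddCommGroup T] [Module Aᵐᵒᵖ T] [IsSimpleModule Aᵐᵒᵖ T]
    (p : rightIdeal e →ₗ[Aᵐᵒᵖ] T) {U : Submodule Aᵐᵒᵖ (rightIdeal e)} {u : rightIdeal e}
    (hu : u ∈ U) (hpu : p u ≠ 0) : U = ⊤ := by
  have hker : IsCoatom (LinearMap.ker p) := by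
    apply LinearMap.isCoatom_ker_of_surjective
    exact LinearMap.surjective_of_ne_zero fun h => hpu (by rw [h, LinearMap.zero_apply])
  have : U ⊔ LinearMap.ker p = ⊤ := by
    refine hker.2 _ (lt_of_le_of_ne le_sup_right fun h => hpu ?_)
    have : u ∈ U ⊔ LinearMap.ker p := Submodule.mem_sup_left hu
    rwa [← h] at this
  rcases he.eq_top_or_eq_top k this with h | h
  · exact h
  · exact (hker.1 h).elim

lemma IsPrimitiveIdempotent.surjective_of_comp {e : A} (he : IsPrimitiveIdempotent e)
    {T : Type*} [AddCommGroup T] [Module Aᵐᵒᵖ T] [IsSimpleModule Aᵐᵒᵖ T]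
    (p : rightIdeal e →ₗ[Aᵐᵒᵖ] T) {M : Type*} [AddCommGroup M] [Module Aᵐᵒᵖ M]
    (g : M →ₗ[Aᵐᵒᵖ] rightIdeal e) {m : M} (hm : p (g m) ≠ 0) : Function.Surjective g :=
  LinearMap.range_eq_top.1 (he.eq_top_of_surjective k p (LinearMap.mem_range_self g m) hm)

lemma IsPrimitiveIdempotent.jacobson_eq_ker {e : A} (he : IsPrimitiveIdempotent e)
    {T : Type*} [AddCommGroup T] [Module Aᵐᵒᵖ T] [IsSimpleModule Aᵐᵒᵖ T]
    (p : rightIdeal e →ₗ[Aᵐᵒᵖ] T) (hp : Function.Surjective p) :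
    Module.jacobson Aᵐᵒᵖ (rightIdeal e) = LinearMap.ker p := by
  refine le_antisymm (IsSemisimpleModule.jacobson_le_ker (f := p)) (le_sInf fun U hU x hx => ?_)
  by_contra hxU
  refine hU.1 ?_
  have h : U ⊔ LinearMap.ker p = ⊤ := by
    refine hU.2 _ (lt_of_le_of_ne le_sup_left fun h => hxU ?_)
    rw [h]
    exact Submodule.mem_sup_right hx
  have hker : LinearMap.ker p ≠ ⊤ := (LinearMap.isCoatom_ker_of_surjective hp).1
  exact (he.eq_top_or_eq_top k h).resolve_right hker

lemma IsPrimitiveIdempotent.nonempty_top_equiv {e : A} (he : IsPrimitiveIdempotent e)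
    {T : Type*} [AddCommGroup T] [Module Aᵐᵒᵖ T] [IsSimpleModule Aᵐᵒᵖ T]
    (p : rightIdeal e →ₗ[Aᵐᵒᵖ] T) (hp : Function.Surjective p) :
    Nonempty (topModule e ≃ₗ[Aᵐᵒᵖ] T) :=
  ⟨Submodule.quotEquivOfEq _ _ (he.jacobson_eq_ker k p hp) ≪≫ₗ p.quotKerEquivOfSurjective hp⟩

lemma IsPrimitiveIdempotent.isSimpleModule_top {e : A} (he : IsPrimitiveIdempotent e) :
    IsSimpleModule Aᵐᵒᵖ (topModule e) := by
  have : Nontrivial (rightIdeal e) :=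
    ⟨⟨rightIdealGen e, 0, fun h => he.ne_zero (congrArg Subtype.val h)⟩⟩
  obtain ⟨m, hm, -⟩ := (eq_top_or_exists_le_coatom (⊥ : Submodule Aᵐᵒᵖ (rightIdeal e))).resolve_left
    bot_ne_top
  have : IsSimpleModule Aᵐᵒᵖ (rightIdeal e ⧸ m) := isSimpleModule_iff_isCoatom.2 hm
  obtain ⟨f⟩ := he.nonempty_top_equiv k m.mkQ m.mkQ_surjective
  exact IsSimpleModule.congr f

lemma IsPrimitiveIdempotent.nonempty_equiv_of_surjective {e f : A} (he : IsPrimitiveIdempotent e)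
    (hf : IsPrimitiveIdempotent f) {T : Type*} [AddCommGroup T] [Module Aᵐᵒᵖ T]
    [IsSimpleModule Aᵐᵒᵖ T] (p : rightIdeal e →ₗ[Aᵐᵒᵖ] T) (hp : Function.Surjective p)
    (q : rightIdeal f →ₗ[Aᵐᵒᵖ] T) (hq : Function.Surjective q) :
    Nonempty (rightIdeal e ≃ₗ[Aᵐᵒᵖ] rightIdeal f) := by
  have : IsNoetherianRing Aᵐᵒᵖ := IsNoetherianRing.of_finite k _
  obtain ⟨g, hg⟩ := exists_rightIdeal_lift he.idem q hq p
  obtain ⟨h, hh⟩ := exists_rightIdeal_lift hf.idem p hp q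
  have := IsSimpleModule.nontrivial Aᵐᵒᵖ T
  obtain ⟨t, ht⟩ := exists_ne (0 : T)
  obtain ⟨x, rfl⟩ := hp t
  obtain ⟨y, hy⟩ := hq (p x)
  have hgs := hf.surjective_of_comp k q g (m := x) (by rwa [hg])
  have hhs := he.surjective_of_comp k p h (m := y) (by rwa [hh, hy])
  have hinj : Function.Injective (h ∘ₗ g) :=
    IsNoetherian.injective_of_surjective_endomorphism _ (hhs.comp hgs)
  exact ⟨LinearEquiv.ofBijective g ⟨Function.Injective.of_comp hinj, hgs⟩⟩

/-- Every simple right module is the top of the right ideal of a primitive idempotent. -/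
lemma exists_isPrimitiveIdempotent_surjective (T : Type*) [AddCommGroup T] [Module Aᵐᵒᵖ T]
    [IsSimpleModule Aᵐᵒᵖ T] : ∃ e : A, IsPrimitiveIdempotent e ∧
      ∃ p : rightIdeal e →ₗ[Aᵐᵒᵖ] T, Function.Surjective p := by
  have : IsArtinianRing Aᵐᵒᵖ := IsArtinianRing.of_finite k _
  have : IsNoetherianRing Aᵐᵒᵖ := IsNoetherianRing.of_finite k _
  have : Module.Finite Aᵐᵒᵖ A := Module.Finite.of_restrictScalars_finite k _ _
  let S : Set (Submodule Aᵐᵒᵖ A) :=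
    {U | ∃ e : A, IsIdempotentElem e ∧ (∃ t : T, MulOpposite.op e • t ≠ 0) ∧ U = rightIdeal e}
  have := IsSimpleModule.nontrivial Aᵐᵒᵖ T
  obtain ⟨t₀, ht₀⟩ := exists_ne (0 : T)
  -- Among the idempotents not killing T, take one with e A minimal. If it decomposed as f + (e -
  -- f), both summands would kill T, hence so would `e`.
  obtain ⟨_, ⟨e, he, ⟨t, ht⟩, rfl⟩, hmin⟩ := wellFounded_lt.has_min S
    ⟨_, 1, IsIdempotentElem.one, ⟨t₀, by rwa [MulOpposite.op_one, one_smul]⟩, rfl⟩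
  have key : ∀ f : A, IsIdempotentElem f → e * f = f → f * e = f → f ≠ e →
      ∀ t : T, MulOpposite.op f • t = 0 := by
    intro f hf h₁ h₂ hne
    by_contra hex
    push Not at hex
    refine hmin _ ⟨f, hf, hex, rfl⟩ (lt_of_le_of_ne ?_ fun h => hne ?_)
    · rw [Submodule.span_singleton_le_iff_mem]
      exact (mem_rightIdeal he).2 h₁
    · have : e ∈ rightIdeal f := h ▸ Submodule.mem_span_singleton_self e
      rw [← h₂, (mem_rightIdeal hf).1 this]
  refine ⟨e, ⟨he, ?_, fun f hf h₁ h₂ => ?_⟩, rightIdealMap e t, ?_⟩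
  · rintro rfl
    exact ht (by rw [MulOpposite.op_zero, zero_smul])
  · by_contra! hne
    have h₃ := key f hf h₁ h₂ hne.2 t
    have h₄ := key (e - f)
      (by
        change (e - f) * (e - f) = e - f
        rw [mul_sub, sub_mul, sub_mul, he.eq, h₁, h₂, hf.eq, sub_self, sub_zero])
      (by rw [mul_sub, he.eq, h₁]) (by rw [sub_mul, he.eq, h₂])
      (fun h => hne.1 (by simpa using h)) t
    rw [MulOpposite.op_sub, sub_smul, h₃, sub_zero] at h₄
    exact ht h₄
  · refine LinearMap.surjective_of_ne_zero fun h => ht ?_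
    exact LinearMap.congr_fun h (rightIdealGen e)

end Primitive

end Algebra

/-! ### Arrow spaces as duals of Hom(f J, T) -/

section Arrows

/-- The right `A`-module `f J`, where `J` is the Jacobson radical of `A`. -/
def radIdeal {A : Type*} [Ring A] (f : A) : Submodule Aᵐᵒᵖ A where
  carrier := {x | f * x = x ∧ x ∈ Ring.jacobson A}
  zero_mem' := ⟨mul_zero f, Ideal.zero_mem _⟩
  add_mem' hx hy := ⟨by rw [mul_add, hx.1, hy.1], Ideal.add_mem _ hx.2 hy.2⟩
  smul_mem' a x hx := ⟨by rw [MulOpposite.smul_eq_mul_unop, ← mul_assoc, hx.1],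
    Ideal.mul_mem_right _ _ hx.2⟩

variable (k : Type*) {A : Type*} [Field k] [Ring A] [Algebra k A]

lemma corner_radical_props {e f : A} (he : IsIdempotentElem e) (hf : IsIdempotentElem f) {x : A}
    (hx : x ∈ corner k f e (radical k A)) : f * x = x ∧ x * e = x ∧ x ∈ Ring.jacobson A := by
  obtain ⟨y, hy, rfl⟩ := hx
  simp only [LinearMap.mulLeftRight_apply]
  refine ⟨?_, ?_, ?_⟩
  · rw [← mul_assoc, ← mul_assoc, hf.eq]
  · rw [mul_assoc, he.eq]
  · exact Ideal.mul_mem_right _ _ (Ideal.mul_mem_left _ _ hy)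

lemma mem_corner_radical {e f x : A} (h₁ : f * x = x) (h₂ : x * e = x)
    (hx : x ∈ Ring.jacobson A) : x ∈ corner k f e (radical k A) :=
  ⟨x, hx, by rw [LinearMap.mulLeftRight_apply, h₁, h₂]⟩

include k in
lemma mem_jacobson_rightIdeal [FiniteDimensional k A] {f : A} (hf : IsIdempotentElem f)
    (x : rightIdeal f) :
    x ∈ Module.jacobson Aᵐᵒᵖ (rightIdeal f) ↔ (x : A) ∈ Ring.jacobson A := by
  have : IsArtinianRing A := IsArtinianRing.of_finite k _
  have : IsArtinianRing Aᵐᵒᵖ := IsArtinianRing.of_finite k _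
  exact jacobson_rightIdeal_iff hf x

include k in
lemma op_mem_jacobson [FiniteDimensional k A] {x : A} :
    MulOpposite.op x ∈ Ring.jacobson Aᵐᵒᵖ ↔ x ∈ Ring.jacobson A := by
  have : IsArtinianRing A := IsArtinianRing.of_finite k _
  have : IsArtinianRing Aᵐᵒᵖ := IsArtinianRing.of_finite k _
  exact op_mem_jacobson_iff

/-- The inclusion of `f J e` in `f J`. -/
def cornerIncl {e f : A} (he : IsIdempotentElem e) (hf : IsIdempotentElem f) :
    corner k f e (radical k A) →+ radIdeal f where
  toFun x := ⟨x, (corner_radical_props k he hf x.2).1, (corner_radical_props k he hf x.2).2.2⟩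
  map_zero' := rfl
  map_add' _ _ := rfl

/-- Right multiplication by `e` from `f J` to `f J e`. -/
def cornerProj {e f : A} (he : IsIdempotentElem e) :
    radIdeal f →+ corner k f e (radical k A) where
  toFun v := ⟨(v : A) * e, mem_corner_radical k
    (by rw [← mul_assoc, v.2.1]) (by rw [mul_assoc, he.eq])
    (Ideal.mul_mem_right _ _ v.2.2)⟩
  map_zero' := Subtype.ext (zero_mul e)
  map_add' _ _ := Subtype.ext (add_mul _ _ e)

variable {k} {e f : A} (he : IsIdempotentElem e) (hf : IsIdempotentElem f)

lemma op_smul_cornerIncl (x : corner k f e (radical k A)) :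
    MulOpposite.op e • cornerIncl k he hf x = cornerIncl k he hf x :=
  Subtype.ext (corner_radical_props k he hf x.2).2.1

lemma cornerIncl_cornerProj (v : radIdeal f) :
    cornerIncl k he hf (cornerProj k he v) = MulOpposite.op e • v :=
  Subtype.ext rfl

lemma cornerProj_cornerIncl (x : corner k f e (radical k A)) :
    cornerProj k he (cornerIncl k he hf x) = x :=
  Subtype.ext (corner_radical_props k he hf x.2).2.1

lemma cornerIncl_smul (c : k) (x : corner k f e (radical k A)) :
    cornerIncl k he hf (c • x) = algebraMap k Aᵐᵒᵖ c • cornerIncl k he hf x :=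
  Subtype.ext (by
    change c • (x : A) = x * algebraMap k A c
    rw [← Algebra.commutes, Algebra.smul_def])

section

variable [FiniteDimensional k A] {T : Type*} [AddCommGroup T] [Module Aᵐᵒᵖ T]
  [IsSimpleModule Aᵐᵒᵖ T]
  (φ : radIdeal f →ₗ[Aᵐᵒᵖ] T)

lemma map_cornerIncl_eq_zero (x : corner k f e (radical k A))
    (hx : (x : A) ∈ corner k f e (radical k A * radical k A)) :
    φ (cornerIncl k he hf x) = 0 := by
  obtain ⟨y, hy, hyx⟩ := hx
  suffices h : ∃ z : corner k f e (radical k A), (z : A) = f * y * e ∧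
      φ (cornerIncl k he hf z) = 0 by
    obtain ⟨z, hz, hz'⟩ := h
    rwa [show x = z from Subtype.ext (hyx.symm.trans hz.symm)]
  clear hyx x
  induction hy using Submodule.mul_induction_on' with
  | mem_mul_mem a ha b hb =>
    let v : radIdeal f :=
      ⟨f * a, by rw [← mul_assoc, hf.eq], Ideal.mul_mem_left _ _ ha⟩
    refine ⟨cornerProj k he (MulOpposite.op b • v), ?_, ?_⟩
    · change f * a * b * e = f * (a * b) * e
      rw [mul_assoc f]
    · rw [cornerIncl_cornerProj, map_smul, map_smul,
        smul_eq_zero_of_mem_jacobson ((op_mem_jacobson k).2 hb), smul_zero]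
  | add a _ b _ iha ihb =>
    obtain ⟨z, hz, hz'⟩ := iha
    obtain ⟨z', hz₁, hz₂⟩ := ihb
    exact ⟨z + z', by rw [Submodule.coe_add, hz, hz₁, mul_add, add_mul],
      by rw [map_add, map_add, hz', hz₂, add_zero]⟩

variable [Module k T] [IsScalarTower k Aᵐᵒᵖ T]

/-- The functional on `f (J / J²) e` given by a linear map `f J → T` and a functional on `T`. -/
def arrowFunctional (ξ : Module.Dual k T) :
    (radIdeal f →ₗ[Aᵐᵒᵖ] T) →ₗ[k] Module.Dual k (arrowSpace k e f) where
  toFun φ := Submodule.liftQ _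
    { toFun := fun x => ξ (φ (cornerIncl k he hf x))
      map_add' := fun x y => by simp only [map_add]
      map_smul' := fun c x => by
        rw [cornerIncl_smul, map_smul, algebraMap_smul, map_smul, RingHom.id_apply] }
    fun x hx => by
      change ξ (φ (cornerIncl k he hf x)) = 0
      rw [map_cornerIncl_eq_zero he hf φ x hx, map_zero]
  map_add' φ ψ := by
    apply Submodule.linearMap_qext
    ext x
    exact ξ.map_add _ _
  map_smul' c φ := by
    apply Submodule.linearMap_qext
    ext x
    exact ξ.map_smul _ _

lemma arrowFunctional_mk (ξ : Module.Dual k T) (x : corner k f e (radical k A)) :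
    arrowFunctional he hf ξ φ (Submodule.Quotient.mk x) = ξ (φ (cornerIncl k he hf x)) := rfl

omit he in
-- The assignment e ↦ t kills the radical of e A, so it factors through an endomorphism of the
-- simple module T, a scalar by Schur's lemma.
lemma exists_eq_smul [IsAlgClosed k] [FiniteDimensional k T] (he : IsPrimitiveIdempotent e)
    (p : rightIdeal e →ₗ[Aᵐᵒᵖ] T) (hp : Function.Surjective p) {t : T}
    (ht : MulOpposite.op e • t = t) : ∃ c : k, t = c • p (rightIdealGen e) := by
  obtain ⟨g, hg⟩ := exists_linearMap_of_ker_le p hp (rightIdealMap e t) fun x hx => by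
    have hx' : x ∈ Module.jacobson Aᵐᵒᵖ (rightIdeal e) := by rwa [he.jacobson_eq_ker k p hp]
    rw [rightIdealMap_apply]
    exact smul_eq_zero_of_mem_jacobson
      ((op_mem_jacobson k).2 ((mem_jacobson_rightIdeal k he.idem x).1 hx')) t
  obtain ⟨c, rfl⟩ := (IsSimpleModule.algebraMap_end_bijective_of_isAlgClosed (A := Aᵐᵒᵖ) (V := T)
    k).2 g
  refine ⟨c, ?_⟩
  rw [← ht]
  exact (hg (rightIdealGen e)).symm

omit he in
/-- For a primitive idempotent `e` with top `T`, the arrow space `f (J / J²) e` is dual to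
`Hom(f J, T)`. -/
lemma arrowFunctional_bijective [IsAlgClosed k] [FiniteDimensional k T]
    (he : IsPrimitiveIdempotent e)
    (p : rightIdeal e →ₗ[Aᵐᵒᵖ] T) (hp : Function.Surjective p) (ξ : Module.Dual k T)
    (hξ : ξ (p (rightIdealGen e)) = 1) :
    Function.Bijective (arrowFunctional he.idem hf ξ) := by
  set t := p (rightIdealGen e) with ht
  have ht0 : t ≠ 0 := fun h => by simp [h] at hξ
  have hte : MulOpposite.op e • t = t := op_smul_map_rightIdealGen he.idem p
  constructor
  · rw [← LinearMap.ker_eq_bot, LinearMap.ker_eq_bot']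
    intro φ hφ
    have h₁ : ∀ x, φ (cornerIncl k he.idem hf x) = 0 := by
      intro x
      obtain ⟨c, hc⟩ := exists_eq_smul (k := k) he p hp (t := φ (cornerIncl k he.idem hf x))
        (by rw [← map_smul, op_smul_cornerIncl])
      have h₂ := LinearMap.congr_fun hφ (Submodule.Quotient.mk x)
      rw [arrowFunctional_mk, hc, map_smul, ← ht, hξ, smul_eq_mul, mul_one] at h₂
      rw [hc, show c = 0 from h₂, zero_smul]
    by_contra hne
    obtain ⟨v, hv⟩ := LinearMap.surjective_of_ne_zero hne t
    apply ht0
    rw [← hte, ← hv, ← map_smul, ← cornerIncl_cornerProj (k := k) he.idem hf v, h₁]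
  · intro lam
    let l : Module.Dual k (corner k f e (radical k A)) := lam ∘ₗ Submodule.mkQ _
    have hl : ∀ x : corner k f e (radical k A),
        (x : A) ∈ corner k f e (radical k A * radical k A) → l x = 0 := fun x hx => by
      change lam (Submodule.Quotient.mk x) = 0
      exact (congrArg lam ((Submodule.Quotient.mk_eq_zero _).2 hx)).trans (map_zero lam)
    suffices h : ∃ φ : radIdeal f →ₗ[Aᵐᵒᵖ] T,
        ∀ x, φ (cornerIncl k he.idem hf x) = l x • t by
      obtain ⟨φ, hφ⟩ := h
      refine ⟨φ, ?_⟩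
      apply Submodule.linearMap_qext
      ext x
      change ξ (φ (cornerIncl k he.idem hf x)) = l x
      rw [hφ, map_smul, hξ, smul_eq_mul, mul_one]
    by_cases hl0 : l = 0
    · exact ⟨0, fun x => by rw [hl0, LinearMap.zero_apply, LinearMap.zero_apply, zero_smul]⟩
    obtain ⟨x₀, hx₀⟩ : ∃ x, l x = 1 := by
      obtain ⟨x, hx⟩ := DFunLike.ne_iff.1 hl0
      exact ⟨(l x)⁻¹ • x, by rw [map_smul, smul_eq_mul, inv_mul_cancel₀ hx]⟩
    -- `N` is the largest submodule of f J on which v ↦ l(v e) vanishes. It contains f J², so the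
    -- quotient is semisimple; the class of `x₀` generates a copy of T there, which splits off.
    let N : Submodule Aᵐᵒᵖ (radIdeal f) :=
      { carrier := {v | ∀ a : Aᵐᵒᵖ, l (cornerProj k he.idem (a • v)) = 0}
        zero_mem' := fun a => by rw [smul_zero, map_zero, map_zero]
        add_mem' := fun {v w} hv hw a => by rw [smul_add, map_add, map_add, hv, hw, add_zero]
        smul_mem' := fun b v hv a => by rw [← mul_smul, hv] }
    have hN : ∀ v, v ∈ N ↔ ∀ a : Aᵐᵒᵖ, l (cornerProj k he.idem (a • v)) = 0 := fun _ => Iff.rfl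
    have : IsArtinianRing Aᵐᵒᵖ := IsArtinianRing.of_finite k _
    have hW : IsSemisimpleModule Aᵐᵒᵖ (radIdeal f ⧸ N) := by
      refine isSemisimpleModule_of_jacobson_le_annihilator fun r hr m => ?_
      obtain ⟨v, rfl⟩ := N.mkQ_surjective m
      rw [← map_smul, Submodule.mkQ_apply, Submodule.Quotient.mk_eq_zero, hN]
      intro a
      apply hl
      have hr' : r.unop ∈ Ring.jacobson A := (op_mem_jacobson k).1 hr
      refine ⟨(v : A) * (r.unop * a.unop), Submodule.mul_mem_mul v.2.2
        (Ideal.mul_mem_right _ _ hr'), ?_⟩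
      rw [LinearMap.mulLeftRight_apply, ← mul_assoc, v.2.1, ← mul_assoc]
      rfl
    let w₀ : radIdeal f ⧸ N := N.mkQ (cornerIncl k he.idem hf x₀)
    have hw₀ : w₀ ≠ 0 := by
      intro h
      have h₁ := (hN _).1 ((Submodule.Quotient.mk_eq_zero N).1 h) 1
      rw [one_smul, cornerProj_cornerIncl, hx₀] at h₁
      exact one_ne_zero h₁
    obtain ⟨θ, hθ⟩ := exists_linearMap_of_ker_le p hp (rightIdealMap e w₀) fun x hx => by
      have hx' : x ∈ Module.jacobson Aᵐᵒᵖ (rightIdeal e) := by rwa [he.jacobson_eq_ker k p hp]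
      rw [rightIdealMap_apply]
      exact smul_eq_zero_of_mem_jacobson
        ((op_mem_jacobson k).2 ((mem_jacobson_rightIdeal k he.idem x).1 hx')) w₀
    have hθt : θ t = w₀ := by
      rw [ht, hθ, rightIdealMap_apply]
      change MulOpposite.op e • N.mkQ (cornerIncl k he.idem hf x₀) = _
      rw [← map_smul, op_smul_cornerIncl]
    have hθinj : Function.Injective θ := LinearMap.injective_of_ne_zero fun h => hw₀ (by
      rw [← hθt, h, LinearMap.zero_apply])
    obtain ⟨ψ, hψ⟩ := IsSemisimpleModule.extension_property θ hθinj LinearMap.id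
    have hψw : ψ w₀ = t := by
      rw [← hθt]
      exact LinearMap.congr_fun hψ t
    -- Since e A e is k e plus its radical part, u (e a e) is a scalar multiple of `u` modulo f J²
    -- e. Hence `x` and `l x • x₀` agree modulo `N`.
    have key : ∀ u, l u = 0 → cornerIncl k he.idem hf u ∈ N := by
      intro u hu
      rw [hN]
      intro a
      let y : rightIdeal e := ⟨e * a.unop * e, (mem_rightIdeal he.idem).2 (by
        rw [← mul_assoc, ← mul_assoc, he.idem.eq])⟩
      obtain ⟨c, hc⟩ := exists_eq_smul (k := k) he p hp (t := p y) (by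
        rw [← map_smul]
        exact congrArg p (Subtype.ext (by
          change e * a.unop * e * e = e * a.unop * e
          rw [mul_assoc, he.idem.eq])))
      have hj : e * a.unop * e - c • e ∈ Ring.jacobson A := by
        have h₁ : y - algebraMap k Aᵐᵒᵖ c • rightIdealGen e ∈
            Module.jacobson Aᵐᵒᵖ (rightIdeal e) := by
          rw [he.jacobson_eq_ker k p hp, LinearMap.mem_ker, map_sub, map_smul, hc,
            algebraMap_smul, sub_self]
        have h₂ := (mem_jacobson_rightIdeal k he.idem _).1 h₁
        have h₃ : ((y - algebraMap k Aᵐᵒᵖ c • rightIdealGen e : rightIdeal e) : A) =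
            e * a.unop * e - e * algebraMap k A c := rfl
        rwa [h₃, ← Algebra.commutes, ← Algebra.smul_def] at h₂
      obtain ⟨hu₁, hu₂, hu₃⟩ := corner_radical_props k he.idem hf u.2
      have h₄ : l (cornerProj k he.idem (a • cornerIncl k he.idem hf u) - c • u) = 0 := by
        apply hl
        refine ⟨u * (e * a.unop * e - c • e), Submodule.mul_mem_mul hu₃ hj, ?_⟩
        rw [LinearMap.mulLeftRight_apply]
        change f * (u * (e * a.unop * e - c • e)) * e = u * a.unop * e - c • (u : A)
        rw [← mul_assoc, hu₁, mul_sub, mul_smul_comm, hu₂, ← mul_assoc, ← mul_assoc, hu₂, sub_mul,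
          smul_mul_assoc, hu₂, mul_assoc _ e e, he.idem.eq]
      rwa [map_sub, l.map_smul, hu, smul_zero, sub_zero] at h₄
    refine ⟨ψ ∘ₗ N.mkQ, fun x => ?_⟩
    have h₁ := key (x - l x • x₀) (by rw [map_sub, map_smul, hx₀, smul_eq_mul, mul_one, sub_self])
    rw [map_sub, cornerIncl_smul, ← Submodule.Quotient.mk_eq_zero N, ← Submodule.mkQ_apply,
      map_sub, map_smul, sub_eq_zero] at h₁
    rw [LinearMap.comp_apply, h₁, map_smul, algebraMap_smul]
    exact congrArg _ hψw

lemma finrank_arrowSpace [IsAlgClosed k] [FiniteDimensional k T]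
    (hf : IsIdempotentElem f) (he : IsPrimitiveIdempotent e)
    (p : rightIdeal e →ₗ[Aᵐᵒᵖ] T) (hp : Function.Surjective p) :
    Module.finrank k (arrowSpace k e f) =
      Module.finrank k (radIdeal f →ₗ[Aᵐᵒᵖ] T) := by
  have ht0 : p (rightIdealGen e) ≠ 0 := by
    intro h
    have := IsSimpleModule.nontrivial Aᵐᵒᵖ T
    obtain ⟨t, ht⟩ := exists_ne (0 : T)
    obtain ⟨x, rfl⟩ := hp t
    exact ht (by rw [map_rightIdeal_apply he.idem, h, smul_zero])
  obtain ⟨ξ, hξ⟩ := Module.Projective.exists_dual_eq_one k ht0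
  rw [← Subspace.dual_finrank_eq]
  exact (LinearEquiv.ofBijective _ (arrowFunctional_bijective hf he p hp ξ hξ)).finrank_eq.symm

end

end Arrows

/-! ### Transport along an equivalence with mod A -/

section GabrielQuiver

variable {k : Type w} [Field k]
  {C : Type u} [Category.{v} C] [HasZeroObject C] [HasShift C ℤ] [Preadditive C]
  [∀ n : ℤ, (shiftFunctor C n).Additive] [Pretriangulated C]
  {n : ℕ} {s : Fin n → C}

/-- The extension groups of the `s i` are computed by the kernels of projective covers. -/
lemma ProjectiveCover.finrank_hom_shift_eq [Linear k C] [∀ n : ℤ, (shiftFunctor C n).Linear k]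
    (hs : IsOrthogonalCollection 2 s) {X : C} (Q : ProjectiveCover s X) (i : Fin n) :
    Module.finrank k (X ⟶ (s i)⟦(1 : ℤ)⟧) = Module.finrank k (Q.ker ⟶ s i) := by
  let φ : (Q.ker ⟶ s i) →ₗ[k] (X ⟶ (s i)⟦(1 : ℤ)⟧) :=
    { toFun := fun h => Q.δ ≫ h⟦(1 : ℤ)⟧'
      map_add' := fun f g => by rw [Functor.map_add, Preadditive.comp_add]
      map_smul' := fun c f => by rw [Functor.map_smul, Linear.comp_smul, RingHom.id_apply] }
  have hφ : ∀ h, φ h = Q.δ ≫ h⟦(1 : ℤ)⟧' := fun _ => rfl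
  -- Otherwise `b` lifts to some `c` through `ι ≫ b`. Then `𝟙 - c ≫ ι` is invertible by minimality
  -- of the cover, yet it kills `b`.
  have hb : ∀ b : Q.obj ⟶ s i, Q.ι ≫ b = 0 := by
    intro b
    by_contra hne
    obtain ⟨c, hc⟩ := hs.lift_of_ne_zero Q.mem_ker Q.projective (Q.ι ≫ b) hne b
    have hiso : IsIso (𝟙 _ - c ≫ Q.ι) := Q.isIso_of_comp_π _ (by
      rw [Preadditive.sub_comp, Category.assoc, triangle_comp₁₂ Q.mem_distTriang, comp_zero,
        sub_zero, Category.id_comp])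
    apply hne
    have : b = 0 := by
      rw [← cancel_epi (𝟙 _ - c ≫ Q.ι), Preadditive.sub_comp, Category.assoc, hc,
        Category.id_comp, sub_self, comp_zero]
    rw [this, comp_zero]
  refine (LinearEquiv.ofBijective φ ⟨?_, fun g => ?_⟩).finrank_eq.symm
  · rw [← LinearMap.ker_eq_bot, LinearMap.ker_eq_bot']
    intro h hh
    obtain ⟨b, rfl⟩ := triangle_desc₁ Q.mem_distTriang h hh
    exact hb b
  · obtain ⟨b, rfl⟩ := triangle_desc₃ Q.mem_distTriang g
      (Q.projective _ (mem_extensionClosure s i) _)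
    exact ⟨(shiftFunctor C (1 : ℤ)).preimage b, by rw [hφ, Functor.map_preimage]⟩

variable {A : Type v} [Ring A]
  (F : (extensionClosure s).FullSubcategory ≌ FGModuleCat.{v} Aᵐᵒᵖ)

/-- The linear map given by a morphism of the extension closure. -/
def linMap {X Y : (extensionClosure s).FullSubcategory} (f : X.obj ⟶ Y.obj) :
    F.functor.obj X →ₗ[Aᵐᵒᵖ] F.functor.obj Y :=
  (F.functor.map (ObjectProperty.homMk f)).hom.hom

section

variable {X Y Z : (extensionClosure s).FullSubcategory}

lemma linMap_comp_apply (f : X.obj ⟶ Y.obj) (g : Y.obj ⟶ Z.obj) (x : F.functor.obj X) :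
    linMap F (f ≫ g) x = linMap F g (linMap F f x) := by
  have h : (ObjectProperty.homMk (f ≫ g) : X ⟶ Z) =
    ObjectProperty.homMk f ≫ ObjectProperty.homMk g := rfl
  unfold linMap
  rw [h, F.functor.map_comp]
  rfl

lemma linMap_id_apply (x : F.functor.obj X) : linMap F (𝟙 X.obj) x = x := by
  have h : (ObjectProperty.homMk (𝟙 X.obj) : X ⟶ X) = 𝟙 X := rfl
  unfold linMap
  rw [h, F.functor.map_id]
  rfl

lemma linMap_injective : Function.Injective (linMap F : (X.obj ⟶ Y.obj) → _) := by
  intro f g hfg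
  have : F.functor.map (ObjectProperty.homMk f : X ⟶ Y) = F.functor.map (ObjectProperty.homMk g) :=
    FGModuleCat.hom_ext hfg
  exact congrArg (fun φ => φ.hom) (F.functor.map_injective this)

lemma exists_linMap_eq (φ : F.functor.obj X →ₗ[Aᵐᵒᵖ] F.functor.obj Y) :
    ∃ f : X.obj ⟶ Y.obj, linMap F f = φ := by
  let G : F.functor.obj X ⟶ F.functor.obj Y := FGModuleCat.ofHom φ
  refine ⟨(F.functor.preimage G).hom, ?_⟩
  have : (ObjectProperty.homMk (F.functor.preimage G).hom : X ⟶ Y) = F.functor.preimage G := rfl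
  unfold linMap
  rw [this, F.functor.map_preimage]
  rfl

lemma linMap_surjective_of_isIso (f : X.obj ⟶ Y.obj) [IsIso f] :
    Function.Surjective (linMap F f) := fun y =>
  ⟨linMap F (inv f) y, by rw [← linMap_comp_apply, IsIso.inv_hom_id, linMap_id_apply]⟩

lemma exists_obj_linearEquiv (M : Type v) [AddCommGroup M] [Module Aᵐᵒᵖ M]
    [Module.Finite Aᵐᵒᵖ M] :
    ∃ X : (extensionClosure s).FullSubcategory, Nonempty (F.functor.obj X ≃ₗ[Aᵐᵒᵖ] M) :=
  ⟨F.functor.objPreimage (FGModuleCat.of _ M),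
    ⟨FGModuleCat.isoToLinearEquiv (F.functor.objObjPreimageIso (FGModuleCat.of _ M))⟩⟩

end

lemma additive_equivalence [IsNoetherianRing Aᵐᵒᵖ] : F.functor.Additive := by
  have : F.inverse.Additive := F.inverse.additive_of_preserves_binary_products
  have : F.symm.functor.Additive := this
  exact F.symm.inverse_additive

section

variable [F.functor.Additive] {X Y Z : (extensionClosure s).FullSubcategory}

lemma linMap_add (f g : X.obj ⟶ Y.obj) : linMap F (f + g) = linMap F f + linMap F g := by
  have h : (ObjectProperty.homMk (f + g) : X ⟶ Y) =
    ObjectProperty.homMk f + ObjectProperty.homMk g := rfl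
  unfold linMap
  rw [h, F.functor.map_add]
  rfl

lemma linMap_zero : linMap F (0 : X.obj ⟶ Y.obj) = 0 := by
  have := linMap_add F (0 : X.obj ⟶ Y.obj) 0
  rwa [add_zero, left_eq_add] at this

lemma linMap_eq_zero_iff {f : X.obj ⟶ Y.obj} : linMap F f = 0 ↔ f = 0 :=
  ⟨fun h => linMap_injective F (h.trans (linMap_zero F).symm), fun h => by rw [h, linMap_zero]⟩

/-- The object `s i` of the extension closure. -/
abbrev simpleObj (s : Fin n → C) (i : Fin n) : (extensionClosure s).FullSubcategory :=
  ⟨s i, mem_extensionClosure s i⟩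

variable [IsNoetherianRing Aᵐᵒᵖ]

lemma linMap_injective_of_triangle (hs : IsOrthogonalCollection 2 s) {f : Y.obj ⟶ X.obj}
    {g : X.obj ⟶ Z.obj} {h : Z.obj ⟶ Y.obj⟦(1 : ℤ)⟧} (hT : Triangle.mk f g h ∈ distTriang C) :
    Function.Injective (linMap F f) := by
  rw [← LinearMap.ker_eq_bot, eq_bot_iff]
  intro m hm
  obtain ⟨W, ⟨e⟩⟩ := exists_obj_linearEquiv F (LinearMap.ker (linMap F f))
  obtain ⟨u, hu⟩ := exists_linMap_eq F ((LinearMap.ker (linMap F f)).subtype ∘ₗ e.toLinearMap)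
  have h0 : u ≫ f = 0 := by
    rw [← linMap_eq_zero_iff F]
    refine LinearMap.ext fun x => ?_
    rw [linMap_comp_apply, hu]
    exact (e x).2
  have hu0 := hs.comp_left_cancel hT W.property Z.property h0
  rw [hu0, linMap_zero] at hu
  have := LinearMap.congr_fun hu (e.symm ⟨m, hm⟩)
  rw [LinearMap.comp_apply, LinearEquiv.coe_coe, e.apply_symm_apply] at this
  exact this.symm

lemma exists_linMap_apply_eq_of_triangle {f : Y.obj ⟶ X.obj}
    {g : X.obj ⟶ Z.obj} {h : Z.obj ⟶ Y.obj⟦(1 : ℤ)⟧} (hT : Triangle.mk f g h ∈ distTriang C)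
    {m : F.functor.obj X} (hm : linMap F g m = 0) : ∃ y, linMap F f y = m := by
  obtain ⟨W, ⟨e⟩⟩ := exists_obj_linearEquiv F (LinearMap.ker (linMap F g))
  obtain ⟨u, hu⟩ := exists_linMap_eq F ((LinearMap.ker (linMap F g)).subtype ∘ₗ e.toLinearMap)
  have h0 : u ≫ g = 0 := by
    rw [← linMap_eq_zero_iff F]
    refine LinearMap.ext fun x => ?_
    rw [linMap_comp_apply, hu]
    exact (e x).2
  obtain ⟨b, rfl⟩ := triangle_lift₂ hT u h0
  refine ⟨linMap F b (e.symm ⟨m, hm⟩), ?_⟩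
  rw [← linMap_comp_apply, hu, LinearMap.comp_apply, LinearEquiv.coe_coe, e.apply_symm_apply]
  rfl

/-- A submodule is the image of some X, and its inclusion comes from a morphism X → `s i` that is a
monomorphism relative to the closure, hence zero or invertible. -/
lemma isSimpleModule_obj (hs : IsOrthogonalCollection 2 s) (i : Fin n) :
    IsSimpleModule Aᵐᵒᵖ (F.functor.obj (simpleObj s i)) := by
  have hnt : Nontrivial (F.functor.obj (simpleObj s i)) := by
    by_contra hnt
    rw [not_nontrivial_iff_subsingleton] at hnt
    exact hs.id_ne_zero i ((linMap_eq_zero_iff F (X := simpleObj s i) (Y := simpleObj s i)).1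
      (LinearMap.ext fun x => Subsingleton.elim _ _))
  rw [isSimpleModule_iff]
  refine { eq_bot_or_eq_top := fun N => ?_ }
  obtain ⟨X, ⟨e⟩⟩ := exists_obj_linearEquiv F N
  obtain ⟨f, hf⟩ := exists_linMap_eq F (Y := simpleObj s i) (N.subtype ∘ₗ e.toLinearMap)
  have hf' : ∀ x, linMap F (Y := simpleObj s i) f x = e x := fun x => LinearMap.congr_fun hf x
  by_cases h0 : f = 0
  · left
    rw [eq_bot_iff]
    intro m hm
    have := hf' (e.symm ⟨m, hm⟩)
    rw [h0, linMap_zero, e.apply_symm_apply] at this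
    exact this.symm
  · right
    have : IsIso f := hs.isIso_of_mono X.property f h0 fun W hW u hu => by
      rw [← linMap_eq_zero_iff F (X := ⟨W, hW⟩)]
      refine LinearMap.ext fun x => e.injective (Subtype.ext ?_)
      rw [← hf', ← linMap_comp_apply F (X := ⟨W, hW⟩), hu, linMap_zero, LinearMap.zero_apply,
        LinearMap.zero_apply, map_zero]
      rfl
    rw [eq_top_iff]
    intro m _
    obtain ⟨x, rfl⟩ := linMap_surjective_of_isIso F (Y := simpleObj s i) f m
    rw [hf']
    exact (e x).2

lemma exists_linearEquiv_of_isSimpleModule (hs : IsOrthogonalCollection 2 s) (T : Type v)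
    [AddCommGroup T] [Module Aᵐᵒᵖ T] [IsSimpleModule Aᵐᵒᵖ T] :
    ∃ i, Nonempty (T ≃ₗ[Aᵐᵒᵖ] F.functor.obj (simpleObj s i)) := by
  obtain ⟨X, ⟨e⟩⟩ := exists_obj_linearEquiv F T
  have := IsSimpleModule.congr e
  by_contra! hne
  have h0 : ∀ i (f : X.obj ⟶ s i), f = 0 := by
    intro i f
    by_contra hf
    have := isSimpleModule_obj F hs i
    have hb := LinearMap.bijective_of_ne_zero
      (fun h => hf ((linMap_eq_zero_iff F (Y := simpleObj s i)).1 h))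
    exact (hne i).false (e.symm ≪≫ₗ LinearEquiv.ofBijective _ hb)
  have h1 : 𝟙 X.obj = 0 := hom_eq_zero_of_hom_simples_eq_zero h0 X.property _
  have := IsSimpleModule.nontrivial Aᵐᵒᵖ (F.functor.obj X)
  obtain ⟨x, hx⟩ := exists_ne (0 : F.functor.obj X)
  rw [← linMap_id_apply F x, h1, linMap_zero] at hx
  exact hx rfl

omit [IsNoetherianRing Aᵐᵒᵖ] in
lemma eq_of_linearEquiv (hs : IsOrthogonalCollection 2 s) {i j : Fin n}
    (e : F.functor.obj (simpleObj s i) ≃ₗ[Aᵐᵒᵖ] F.functor.obj (simpleObj s j)) : i = j := by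
  obtain ⟨f, hf⟩ := exists_linMap_eq F e.toLinearMap
  by_cases h0 : f = 0
  · exfalso
    rw [h0, linMap_zero] at hf
    refine hs.id_ne_zero i ((linMap_eq_zero_iff F (X := simpleObj s i) (Y := simpleObj s i)).1
      (LinearMap.ext fun x => e.injective ?_))
    rw [LinearMap.zero_apply, map_zero]
    exact (LinearMap.congr_fun hf _).symm
  · exact (hs.eq_and_isIso h0).1

end

section

variable (k) [Algebra k A] [FiniteDimensional k A] [F.functor.Additive] [IsTriangulated C]

include k in
/-- The kernel of the projective cover of `s j` corresponds to the radical of the right ideal of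
a primitive idempotent. -/
lemma nonempty_ker_linearEquiv_radIdeal (hs : IsOrthogonalCollection 2 s) {j : Fin n}
    (Q : ProjectiveCover s (s j)) {e : A} (he : IsPrimitiveIdempotent e)
    (p : rightIdeal e →ₗ[Aᵐᵒᵖ] F.functor.obj (simpleObj s j)) (hp : Function.Surjective p) :
    Nonempty (F.functor.obj ⟨Q.ker, Q.mem_ker⟩ ≃ₗ[Aᵐᵒᵖ] radIdeal e) := by
  have : IsNoetherianRing Aᵐᵒᵖ := IsNoetherianRing.of_finite k _
  have hsimple := isSimpleModule_obj F hs j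
  let O : (extensionClosure s).FullSubcategory := ⟨Q.obj, Q.mem_obj (mem_extensionClosure s j)⟩
  let K : (extensionClosure s).FullSubcategory := ⟨Q.ker, Q.mem_ker⟩
  let π : F.functor.obj O →ₗ[Aᵐᵒᵖ] F.functor.obj (simpleObj s j) :=
    linMap F (X := O) (Y := simpleObj s j) Q.π
  let ι : F.functor.obj K →ₗ[Aᵐᵒᵖ] F.functor.obj O := linMap F (X := K) (Y := O) Q.ι
  have hι : Function.Injective ι :=
    linMap_injective_of_triangle F (X := O) (Y := K) (Z := simpleObj s j) hs Q.mem_distTriang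
  have hexact : ∀ m, π m = 0 → ∃ y, ι y = m := fun m hm =>
    exists_linMap_apply_eq_of_triangle F (X := O) (Y := K) (Z := simpleObj s j)
      Q.mem_distTriang hm
  have hπι : ∀ y, π (ι y) = 0 := fun y => by
    change linMap F (X := O) (Y := simpleObj s j) Q.π (linMap F (X := K) (Y := O) Q.ι y) = 0
    rw [← linMap_comp_apply, triangle_comp₁₂ Q.mem_distTriang, linMap_zero, LinearMap.zero_apply]
  have hπ : Function.Surjective π := LinearMap.surjective_of_ne_zero fun h =>
    Q.π_ne_zero hs ((linMap_eq_zero_iff F (X := O) (Y := simpleObj s j)).1 h)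
  obtain ⟨α, hα⟩ := exists_rightIdeal_lift he.idem π hπ p
  have : IsNoetherian Aᵐᵒᵖ (rightIdeal e) := inferInstance
  obtain ⟨X, ⟨θ⟩⟩ := exists_obj_linearEquiv F (rightIdeal e)
  obtain ⟨g, hg⟩ := exists_linMap_eq F (Y := simpleObj s j) (p ∘ₗ θ.toLinearMap)
  have hg' : ∀ x, linMap F (Y := simpleObj s j) g x = p (θ x) :=
    fun x => LinearMap.congr_fun hg x
  have := IsSimpleModule.nontrivial Aᵐᵒᵖ (F.functor.obj (simpleObj s j))
  obtain ⟨t, ht⟩ := exists_ne (0 : F.functor.obj (simpleObj s j))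
  obtain ⟨x₀, rfl⟩ := hp t
  have hg0 : g ≠ 0 := by
    intro h0
    apply ht
    have := hg' (θ.symm x₀)
    rw [h0, linMap_zero, LinearMap.zero_apply, θ.apply_symm_apply] at this
    exact this.symm
  -- Two projective covers of one simple module are compared: `α` lifts from e A, `β` from the image
  -- of Q. Primitivity of `e` makes `β ∘ₗ α` injective, and minimality of Q makes `b ≫ a`
  -- invertible, so `α` is bijective.
  obtain ⟨b, hb⟩ := hs.lift_of_ne_zero X.property Q.projective g hg0 Q.π
  let β : F.functor.obj O →ₗ[Aᵐᵒᵖ] rightIdeal e := θ.toLinearMap ∘ₗ linMap F (X := O) b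
  have hβ : ∀ y, p (β y) = π y := fun y => by
    change p (θ (linMap F (X := O) b y)) = linMap F (X := O) (Y := simpleObj s j) Q.π y
    rw [← hg', ← linMap_comp_apply F (X := O) (Z := simpleObj s j), hb]
  have hβα : Function.Injective (β ∘ₗ α) :=
    IsNoetherian.injective_of_surjective_endomorphism _
      (he.surjective_of_comp k p (β ∘ₗ α) (m := x₀) (by rwa [LinearMap.comp_apply, hβ, hα]))
  have hαi : Function.Injective α := fun x y hxy => hβα (congrArg β hxy)
  obtain ⟨a, ha⟩ := exists_linMap_eq F (Y := O) (α ∘ₗ θ.toLinearMap)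
  have ha' : ∀ x, linMap F (Y := O) a x = α (θ x) := fun x => LinearMap.congr_fun ha x
  have hiso : IsIso (b ≫ a) := Q.isIso_of_comp_π _ (by
    apply linMap_injective F (X := O) (Y := simpleObj s j)
    refine LinearMap.ext fun y => ?_
    rw [linMap_comp_apply F (Y := O), linMap_comp_apply F (Y := X) (X := O) (Z := O), ha']
    exact (hα _).trans (hβ y))
  have hαs : Function.Surjective α := by
    intro y
    obtain ⟨z, hz⟩ := linMap_surjective_of_isIso F (X := O) (Y := O) (b ≫ a) y
    rw [linMap_comp_apply F (Y := X) (X := O) (Z := O), ha'] at hz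
    exact ⟨_, hz⟩
  let α' := LinearEquiv.ofBijective α ⟨hαi, hαs⟩
  have hα' : ∀ x, α' x = α x := fun _ => rfl
  let ψ : F.functor.obj K →ₗ[Aᵐᵒᵖ] A := (rightIdeal e).subtype ∘ₗ α'.symm.toLinearMap ∘ₗ ι
  have hψ : ∀ y, ψ y = (α'.symm (ι y) : A) := fun _ => rfl
  have hψi : Function.Injective ψ :=
    (rightIdeal e).injective_subtype.comp (α'.symm.injective.comp hι)
  have hrad : ∀ x : rightIdeal e, (x : A) ∈ Ring.jacobson A ↔ p x = 0 := fun x => by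
    rw [← mem_jacobson_rightIdeal k he.idem, he.jacobson_eq_ker k p hp, LinearMap.mem_ker]
  have hrange : LinearMap.range ψ = radIdeal e := by
    ext x
    rw [LinearMap.mem_range]
    constructor
    · rintro ⟨y, rfl⟩
      refine ⟨(mem_rightIdeal he.idem).1 (α'.symm (ι y)).2, (hrad (α'.symm (ι y))).2 ?_⟩
      rw [← hα, ← hα', α'.apply_symm_apply, hπι]
    · rintro ⟨h₁, h₂⟩
      let z : rightIdeal e := ⟨x, (mem_rightIdeal he.idem).2 h₁⟩
      obtain ⟨y, hy⟩ := hexact (α z) ((hα z).trans ((hrad z).1 h₂))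
      refine ⟨y, ?_⟩
      rw [hψ, hy, ← hα', α'.symm_apply_apply]
  exact ⟨LinearEquiv.ofInjective ψ hψi ≪≫ₗ LinearEquiv.ofEq _ _ hrange⟩

end

end GabrielQuiver

/-! ### Part (b)(ii): the Gabriel quiver -/

section GabrielQuiver

variable {k : Type w} [Field k]
  {C : Type u} [Category.{v} C] [HasZeroObject C] [HasShift C ℤ] [Preadditive C]
  [∀ n : ℤ, (shiftFunctor C n).Additive] [Pretriangulated C] [IsTriangulated C]
  [Linear k C] [∀ n : ℤ, (shiftFunctor C n).Linear k]
  {n : ℕ} {s : Fin n → C}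
  {A : Type v} [Ring A] [Algebra k A] [FiniteDimensional k A]
  (F : (extensionClosure s).FullSubcategory ≌ FGModuleCat.{v} Aᵐᵒᵖ) [F.functor.Linear k]

omit [IsTriangulated C] [∀ n : ℤ, (shiftFunctor C n).Linear k] [FiniteDimensional k A] in
lemma linMap_smul_apply {X Y : (extensionClosure s).FullSubcategory} (c : k) (f : X.obj ⟶ Y.obj)
    (x : F.functor.obj X) : linMap F (c • f) x = algebraMap k Aᵐᵒᵖ c • linMap F f x := by
  have h : (ObjectProperty.homMk (c • f) : X ⟶ Y) = c • ObjectProperty.homMk f := rfl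
  unfold linMap
  rw [h, F.functor.map_smul, fgModuleCat_smul_apply]

variable [F.functor.Additive]

lemma finrank_hom_shift_eq_finrank_arrowSpace [IsAlgClosed k] (hs : IsOrthogonalCollection 2 s)
    {i j : Fin n} (Q : ProjectiveCover s (s j)) {e f : A} (he : IsPrimitiveIdempotent e)
    (hf : IsPrimitiveIdempotent f)
    (p : rightIdeal e →ₗ[Aᵐᵒᵖ] F.functor.obj (simpleObj s i)) (hp : Function.Surjective p)
    (q : rightIdeal f →ₗ[Aᵐᵒᵖ] F.functor.obj (simpleObj s j)) (hq : Function.Surjective q) :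
    Module.finrank k (arrowSpace k e f) = Module.finrank k (s j ⟶ (s i)⟦(1 : ℤ)⟧) := by
  have : IsNoetherianRing Aᵐᵒᵖ := IsNoetherianRing.of_finite k _
  have := isSimpleModule_obj F hs i
  -- The vector space structure is restricted from A, which is what linearity of F makes compatible
  -- with the Hom spaces.
  let _ : Module k (F.functor.obj (simpleObj s i)) := Module.compHom _ (algebraMap k Aᵐᵒᵖ)
  have hsmul : ∀ (c : k) (x : F.functor.obj (simpleObj s i)), c • x = algebraMap k Aᵐᵒᵖ c • x :=
    fun _ _ => rfl
  have : IsScalarTower k Aᵐᵒᵖ (F.functor.obj (simpleObj s i)) :=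
    ⟨fun c a x => by rw [hsmul, Algebra.smul_def, mul_smul]⟩
  have : FiniteDimensional k (F.functor.obj (simpleObj s i)) := Module.Finite.trans Aᵐᵒᵖ _
  obtain ⟨θ⟩ := nonempty_ker_linearEquiv_radIdeal k F hs Q hf q hq
  rw [finrank_arrowSpace hf.idem he p hp, Q.finrank_hom_shift_eq hs]
  let φ : (Q.ker ⟶ s i) →ₗ[k] (radIdeal f →ₗ[Aᵐᵒᵖ] F.functor.obj (simpleObj s i)) :=
    { toFun := fun h =>
        linMap F (X := ⟨Q.ker, Q.mem_ker⟩) (Y := simpleObj s i) h ∘ₗ θ.symm.toLinearMap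
      map_add' := fun g h => by rw [linMap_add, LinearMap.add_comp]
      map_smul' := fun c h => LinearMap.ext fun x =>
        linMap_smul_apply F (X := ⟨Q.ker, Q.mem_ker⟩) (Y := simpleObj s i) c h (θ.symm x) }
  have hφ : ∀ h x, φ h x =
    linMap F (X := ⟨Q.ker, Q.mem_ker⟩) (Y := simpleObj s i) h (θ.symm x) := fun _ _ => rfl
  refine (LinearEquiv.ofBijective φ ⟨fun g h hgh => ?_, fun ψ => ?_⟩).finrank_eq.symm
  · apply linMap_injective F (X := ⟨Q.ker, Q.mem_ker⟩) (Y := simpleObj s i)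
    refine LinearMap.ext fun x => ?_
    have := LinearMap.congr_fun hgh (θ x)
    rwa [hφ, hφ, θ.symm_apply_apply] at this
  · obtain ⟨h, hh⟩ := exists_linMap_eq F (X := ⟨Q.ker, Q.mem_ker⟩) (Y := simpleObj s i)
      (ψ ∘ₗ θ.toLinearMap)
    refine ⟨h, LinearMap.ext fun x => ?_⟩
    rw [hφ, hh, LinearMap.comp_apply, LinearEquiv.coe_coe, θ.apply_symm_apply]

omit [F.functor.Additive] in
theorem exists_isGabrielQuiver [IsAlgClosed k] (hs : IsOrthogonalCollection 2 s)
    (h : ∀ X, extensionClosure s X → HasEnvelope (suspend (extensionClosure s) 1) X) :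
    ∃ e : CollectionQuiver k s → A, IsGabrielQuiver k A (CollectionQuiver k s) e ∧
      ∀ i : Fin n, Nonempty (topModule (e i) ≃ₗ[Aᵐᵒᵖ] F.functor.obj (simpleObj s i)) := by
  have : IsNoetherianRing Aᵐᵒᵖ := IsNoetherianRing.of_finite k _
  have := additive_equivalence F
  have hsimple := isSimpleModule_obj F hs
  choose e he p hp using fun i : Fin n =>
    exists_isPrimitiveIdempotent_surjective k (A := A) (F.functor.obj (simpleObj s i))
  refine ⟨e, ⟨he, fun f hf => ?_, fun i j => ?_⟩, fun i => (he i).nonempty_top_equiv k (p i) (hp i)⟩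
  · have := hf.isSimpleModule_top k
    obtain ⟨i, ⟨θ⟩⟩ := exists_linearEquiv_of_isSimpleModule F hs (topModule f)
    refine ⟨i, hf.nonempty_equiv_of_surjective k (he i) (θ.toLinearMap ∘ₗ Submodule.mkQ _)
      (θ.surjective.comp (Submodule.mkQ_surjective _)) (p i) (hp i),
      fun (j : Fin n) ⟨ρ⟩ => ?_⟩
    obtain ⟨σ⟩ := hf.nonempty_top_equiv k (p j ∘ₗ ρ.toLinearMap) ((hp j).comp ρ.surjective)
    exact eq_of_linearEquiv F hs (σ.symm ≪≫ₗ θ)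
  · obtain ⟨Q⟩ := nonempty_projectiveCover (h _ (mem_extensionClosure s j))
    exact ⟨Module.finBasisOfFinrankEq k _
      (finrank_hom_shift_eq_finrank_arrowSpace F hs Q (he i) (he j) (p i) (hp i) (p j) (hp j))⟩

end GabrielQuiver

end SimpleMinded

theorem mainTheorem2 {k : Type w} [Field k]
    {C : Type u} [Category.{v} C] [HasZeroObject C] [HasShift C ℤ] [Preadditive C]
    [∀ n : ℤ, (shiftFunctor C n).Additive] [Pretriangulated C] [IsTriangulated C]
    [Linear k C] [∀ n : ℤ, (shiftFunctor C n).Linear k]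
    [∀ X Y : C, FiniteDimensional k (X ⟶ Y)] [IsIdempotentComplete C]
    {n : ℕ} (s : Fin n → C) (hs : SimpleMinded.IsOrthogonalCollection 2 s) :
    -- envelopes exist for simple minded systems
    ((∃ m : ℕ, 2 ≤ m ∧ SimpleMinded.IsSimpleMindedSystem m s) →
      ∀ X, SimpleMinded.extensionClosure s X →
        SimpleMinded.HasEnvelope
          (SimpleMinded.suspend (SimpleMinded.extensionClosure s) 1) X) ∧
    ((∀ X, SimpleMinded.extensionClosure s X →
        SimpleMinded.HasEnvelope
          (SimpleMinded.suspend (SimpleMinded.extensionClosure s) 1) X) →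
      -- the extension closure is a module category
      (∃ (A : Type v) (_ : Ring A) (_ : Algebra k A), FiniteDimensional k A ∧
        ∃ F : (SimpleMinded.extensionClosure s).FullSubcategory ≌ FGModuleCat.{v} Aᵐᵒᵖ,
          F.functor.Linear k) ∧
      -- the Gabriel quiver
      (IsAlgClosed k → ∀ (A : Type v) [Ring A] [Algebra k A] [FiniteDimensional k A]
        (F : (SimpleMinded.extensionClosure s).FullSubcategory ≌ FGModuleCat.{v} Aᵐᵒᵖ)
        [F.functor.Linear k],
        ∃ e : SimpleMinded.CollectionQuiver k s → A,
          SimpleMinded.IsGabrielQuiver k A (SimpleMinded.CollectionQuiver k s) e ∧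
          ∀ i : Fin n, Nonempty (SimpleMinded.topModule (e i) ≃ₗ[Aᵐᵒᵖ]
            F.functor.obj ⟨s i, SimpleMinded.mem_extensionClosure s i⟩))) := by
  refine ⟨fun ⟨m, hm, hs'⟩ X _ => hs'.hasEnvelope k hs hm X, fun h => ⟨?_, ?_⟩⟩
  · exact SimpleMinded.exists_equivalence hs h
  · intro hk A _ _ _ F _
    exact SimpleMinded.exists_isGabrielQuiver F hs h
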